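/- Let $\{e(t)\}_{t\in\mathbb Z}$ be i.i.d. real random variables with $E\,e(t)=0$ and finite variance $\sigma^2$, let $a(j)$, $j\in\mathbb Z$, be real constants with $\sum_{j\in\mathbb Z}|a(j)|<\infty$, and let $X(t)=\sum_{j\in\mathbb Z}a(j)e(t-j)$. For $M>0$ put $$\Theta=[-M,M]\times[-M,M]\times[0,\pi]\times[-M,M]\times[-M,M]\times[0,\pi].$$ Let $\theta^0=(A^0,B^0,\alpha^0,C^0,D^0,\beta^0)$ be an interior point of $\Theta$ with $(A^0)^2+(B^0)^2>0$, $(C^0)^2+(D^0)^2>0$ and $\beta^0$ not one of the countably many rational multiples of $\pi$. Suppose that one observes $$y(t)=A^0\cos(\alpha^0t)+B^0\sin(\alpha^0t)+C^0\cos(\beta^0t^2)+D^0\sin(\beta^0t^2)+X(t),\qquad t=1,\dots,n,$$ and for every $n\ge1$ let $\hat\theta_n=(\hat A,\hat B,\hat\alpha,\hat C,\hat D,\hat\beta)$ be a least squares estimator, that is, any minimiser over $\theta=(A,B,\alpha,C,D,\beta)\in\Theta$ of $$Q_n(\theta)=\sum_{t=1}^n\bigl(y(t)-A\cos(\alpha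 t)-B\sin(\alpha t)-C\cos(\beta t^2)-D\sin(\beta t^2)\bigr)^2.$$ Then $\hat\theta_n$ is strongly consistent: $\hat\theta_n\to\theta^0$ almost surely as $n\to\infty$. -/

import Mathlib

open MeasureTheory ProbabilityTheory Filter Topology

namespace ChirpLike

/-- A parameter vector `(A, B, α, C, D, β)`. -/
abbrev Param : Type := ℝ × ℝ × ℝ × ℝ × ℝ × ℝ

/-- The compact parameter space `[-M, M]² × [0, π] × [-M, M]² × [0, π]`. -/
def paramSpace (M : ℝ) : Set Param :=
  Set.Icc (-M) M ×ˢ Set.Icc (-M) M ×ˢ Set.Icc 0 Real.pi ×ˢ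
    Set.Icc (-M) M ×ˢ Set.Icc (-M) M ×ˢ Set.Icc 0 Real.pi

/-- The noise-free chirp-like signal
`A cos(α t) + B sin(α t) + C cos(β t²) + D sin(β t²)`. -/
noncomputable def signal : Param → ℕ → ℝ
  | (A, B, α, C, D, β), t =>
    A * Real.cos (α * t) + B * Real.sin (α * t)
      + C * Real.cos (β * (t : ℝ) ^ 2) + D * Real.sin (β * (t : ℝ) ^ 2)

/-- The error sum of squares of the data `y 1, …, y n` at the parameter `θ`. -/
noncomputable def errorSS (y : ℕ → ℝ) (n : ℕ) (θ : Param) : ℝ :=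
  ∑ t ∈ Finset.Icc 1 n, (y t - signal θ t) ^ 2

/-- `θ` is a least squares estimate from `y 1, …, y n`: a global minimiser of the
error sum of squares over the parameter space. -/
def IsLSE (M : ℝ) (y : ℕ → ℝ) (n : ℕ) (θ : Param) : Prop :=
  θ ∈ paramSpace M ∧ ∀ θ' ∈ paramSpace M, errorSS y n θ ≤ errorSS y n θ'

/-- `X(t) = ∑_{j ∈ ℤ} a(j) e(t - j)` (almost surely), where `∑ |a(j)| < ∞` and the `e(t)` are
independent and identically distributed random variables with mean `0` and variance `σ²`. -/
structure IsLinearProcess {Ω : Type*} [MeasurableSpace Ω] (μ : Measure Ω)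
    (a : ℤ → ℝ) (σ : ℝ) (e X : ℤ → Ω → ℝ) : Prop where
  summable_abs : Summable fun j => |a j|
  measurable : ∀ t, Measurable (e t)
  indep : iIndepFun e μ
  identDistrib : ∀ s t, IdentDistrib (e s) (e t) μ μ
  memLp_two : ∀ t, MemLp (e t) 2 μ
  mean_zero : ∀ t, ∫ ω, e t ω ∂μ = 0
  variance_eq : ∀ t, variance (e t) μ = σ ^ 2
  hasSum : ∀ t, ∀ᵐ ω ∂μ, HasSum (fun j => a j * e (t - j) ω) (X t ω)

/-- The observations `y(t) = signal + X(t)`. -/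
noncomputable def observation {Ω : Type*} (θ₀ : Param) (X : ℤ → Ω → ℝ) (t : ℕ) (ω : Ω) : ℝ :=
  signal θ₀ t + X (t : ℤ) ω

end ChirpLike

/-! Write the signal as the real part of `a * phase 0 α + c * phase β 0` with `a = A - iB`, `c = C -
iD`. Since the least squares estimate fits no worse than the truth, the mean square distance between
fitted and true signal is at most twice an average of noise times the difference of the two signals.
Two facts finish the proof.

Noise: almost surely, averages of `X t` against `phase (β n) (γ n)` vanish for all sequences `β`,
`γ` at once, which is uniformity in the frequencies (`IsLinearProcess.ae_tendsto_avg_mul_phase`).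
Two van der Corput differencings remove the phase and leave averages of fourfold products of the
innovations, which vanish by orthogonality. Truncation removes boundedness, and a summable maximal
bound allows summation over the lags `j`.

Identifiability: if the mean square distance tends to zero, the limiting parameters are the true
ones (`eq_of_tendsto_avg_sq`). Testing against a phase at the true chirp rate shows that the
limiting rate is not a rational multiple of `π`; Weyl's theorem then separates the sinusoid from the
chirp. As the frequency errors come with no rate, testing cannot read off the amplitudes. They are
found from dilations `t ↦ k * t`, under which a pure phase turns into a power of itself.

Both facts hold along any filter below `atTop`, so compactness of the parameter space and
ultrafilters conclude. -/

namespace ChirpLike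

/-! ### Averages over `1, …, n` -/

section Average

variable {E : Type*} [NormedAddCommGroup E] [NormedSpace ℝ E]

/-- The average `(u 1 + ⋯ + u n) / n`. -/
noncomputable def avg (u : ℕ → E) (n : ℕ) : E := (n : ℝ)⁻¹ • ∑ t ∈ Finset.Icc 1 n, u t

theorem avg_add (u v : ℕ → E) (n : ℕ) : avg (fun t => u t + v t) n = avg u n + avg v n := by
  simp [avg, Finset.sum_add_distrib]

theorem avg_sub (u v : ℕ → E) (n : ℕ) : avg (fun t => u t - v t) n = avg u n - avg v n := by
  simp [avg, smul_sub]

theorem avg_sum {ι : Type*} (s : Finset ι) (u : ι → ℕ → E) (n : ℕ) :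
    avg (fun t => ∑ i ∈ s, u i t) n = ∑ i ∈ s, avg (u i) n := by
  simp only [avg]
  rw [Finset.sum_comm, Finset.smul_sum]

theorem avg_const {n : ℕ} (hn : n ≠ 0) (c : E) : avg (fun _ => c) n = c := by
  have : (n : ℝ) ≠ 0 := by exact_mod_cast hn
  simp [avg, ← Nat.cast_smul_eq_nsmul ℝ, smul_smul, this]

theorem avg_congr {u v : ℕ → E} {n : ℕ} (h : ∀ t, u t = v t) : avg u n = avg v n := by
  rw [funext h]

theorem norm_avg_le (u : ℕ → E) (n : ℕ) : ‖avg u n‖ ≤ avg (fun t => ‖u t‖) n := by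
  simp only [avg, norm_smul, norm_inv, Real.norm_natCast, smul_eq_mul]
  gcongr
  exact norm_sum_le _ _

theorem map_avg {F : Type*} [NormedAddCommGroup F] [NormedSpace ℝ F] (L : E →L[ℝ] F)
    (u : ℕ → E) (n : ℕ) : L (avg u n) = avg (fun t => L (u t)) n := by
  simp [avg]

theorem avg_mono {u v : ℕ → ℝ} {n : ℕ} (h : ∀ t, u t ≤ v t) : avg u n ≤ avg v n := by
  simp only [avg, smul_eq_mul]
  gcongr
  exact h _

theorem avg_nonneg {u : ℕ → ℝ} {n : ℕ} (h : ∀ t, 0 ≤ u t) : 0 ≤ avg u n := by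
  simp only [avg, smul_eq_mul]
  exact mul_nonneg (by positivity) (Finset.sum_nonneg fun t _ => h t)

theorem avg_const_mul {𝕜 : Type*} [RCLike 𝕜] (c : 𝕜) (u : ℕ → 𝕜) (n : ℕ) :
    avg (fun t => c * u t) n = c * avg u n := by
  simp [avg, ← Finset.mul_sum]

theorem avg_le_const {u : ℕ → ℝ} {n : ℕ} {c : ℝ} (hc : 0 ≤ c) (h : ∀ t, u t ≤ c) :
    avg u n ≤ c := by
  rcases eq_or_ne n 0 with rfl | hn
  · simpa [avg] using hc
  · exact (avg_mono h).trans_eq (avg_const hn c)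

theorem sq_avg_le (u : ℕ → ℝ) (n : ℕ) : avg u n ^ 2 ≤ avg (fun t => u t ^ 2) n := by
  rcases eq_or_ne n 0 with rfl | hn
  · simp [avg]
  have hn' : (0 : ℝ) < n := by exact_mod_cast Nat.pos_of_ne_zero hn
  have := sq_sum_le_card_mul_sum_sq (s := Finset.Icc 1 n) (f := u)
  simp only [Nat.card_Icc, add_tsub_cancel_right] at this
  simp only [avg, smul_eq_mul, mul_pow]
  rw [inv_pow, inv_mul_le_iff₀ (by positivity), ← mul_assoc]
  convert this using 1
  field_simp

/-- Averages of a bounded sequence are nearly shift invariant. -/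
theorem norm_avg_shift_sub_le {u : ℕ → E} {C : ℝ} (hu : ∀ t, ‖u t‖ ≤ C) (h n : ℕ) :
    ‖avg (fun t => u (t + h)) n - avg u n‖ ≤ (n : ℝ)⁻¹ * (2 * h * C) := by
  -- The two sums share all but `h` terms at each end, hence the factor `2 * h`.
  have hd : ∀ m, ∑ t ∈ Finset.Icc 1 m, u (t + h) - ∑ t ∈ Finset.Icc 1 m, u t
      = ∑ i ∈ Finset.range h, (u (m + 1 + i) - u (1 + i)) := by
    intro m
    induction m with
    | zero => simp
    | succ m ih =>
      rw [Finset.sum_Icc_succ_top (by omega), Finset.sum_Icc_succ_top (by omega),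
        add_sub_add_comm, ih, ← sub_eq_zero, Finset.sum_sub_distrib, Finset.sum_sub_distrib]
      have h1 := Finset.sum_range_succ (fun i => u (m + 1 + i)) h
      have h2 := Finset.sum_range_succ' (fun i => u (m + 1 + i)) h
      have h3 : ∑ i ∈ Finset.range h, u (m + 1 + 1 + i)
          = ∑ i ∈ Finset.range h, u (m + 1 + (i + 1)) :=
        Finset.sum_congr rfl fun i _ => by congr 1; omega
      rw [h1] at h2
      rw [h3]
      simp only [add_zero] at h2
      have h4 := sub_eq_zero.2 h2
      rw [← h4]; abel
  simp only [avg]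
  rw [← smul_sub, hd, norm_smul, norm_inv, Real.norm_natCast]
  gcongr
  refine (norm_sum_le _ _).trans ((Finset.sum_le_card_nsmul _ _ (2 * C) fun i _ => ?_).trans ?_)
  · exact (norm_sub_le _ _).trans (by linarith [hu (n + 1 + i), hu (1 + i)])
  · simp; linarith

end Average

/-! ### Van der Corput's inequality -/

theorem tendsto_natCast_inv_mul {l : Filter ℕ} (hl : l ≤ atTop) (c : ℝ) :
    Tendsto (fun n : ℕ => (n : ℝ)⁻¹ * c) l (𝓝 0) := by
  simpa using (tendsto_inv_atTop_nhds_zero_nat (𝕜 := ℝ)).mul_const c |>.mono_left hl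

/-- Cauchy–Schwarz moves the square inside the average. Of the expanded products, the `H` diagonal
ones are at most `C ^ 2` each, and the others are autocorrelations. -/
theorem sq_norm_avg_le_van_der_corput {u : ℕ → ℂ} {C : ℝ} (hC : 0 ≤ C) (hu : ∀ t, ‖u t‖ ≤ C)
    {H : ℕ} (n : ℕ) :
    ‖avg (fun t => ∑ h ∈ Finset.range H, u (t + h)) n‖ ^ 2 ≤
      H * C ^ 2 + ∑ p ∈ (Finset.range H).offDiag,
        ‖avg (fun t => u (t + p.1) * (starRingEnd ℂ) (u (t + p.2))) n‖ := by
  have h1 : ‖avg (fun t => ∑ h ∈ Finset.range H, u (t + h)) n‖ ^ 2 ≤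
      avg (fun t => ‖∑ h ∈ Finset.range H, u (t + h)‖ ^ 2) n :=
    (pow_le_pow_left₀ (norm_nonneg _) (norm_avg_le _ n) 2).trans (sq_avg_le _ n)
  have h2 : ((avg (fun t => ‖∑ h ∈ Finset.range H, u (t + h)‖ ^ 2) n : ℝ) : ℂ) =
      ∑ p ∈ Finset.range H ×ˢ Finset.range H,
        avg (fun t => u (t + p.1) * (starRingEnd ℂ) (u (t + p.2))) n := by
    rw [← avg_sum]
    have := map_avg Complex.ofRealCLM (fun t => ‖∑ h ∈ Finset.range H, u (t + h)‖ ^ 2) n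
    simp only [Complex.ofRealCLM_apply] at this
    rw [this]
    refine avg_congr fun t => ?_
    rw [Complex.ofReal_pow, ← Complex.mul_conj', map_sum, Finset.sum_mul_sum,
      Finset.sum_product]
  have h3 : ‖((avg (fun t => ‖∑ h ∈ Finset.range H, u (t + h)‖ ^ 2) n : ℝ) : ℂ)‖ ≤
      H * C ^ 2 + ∑ p ∈ (Finset.range H).offDiag,
        ‖avg (fun t => u (t + p.1) * (starRingEnd ℂ) (u (t + p.2))) n‖ := by
    rw [h2, ← Finset.diag_union_offDiag, Finset.sum_union (Finset.disjoint_diag_offDiag _)]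
    refine (norm_add_le _ _).trans (add_le_add ?_ (norm_sum_le _ _))
    refine (norm_sum_le _ _).trans ?_
    refine (Finset.sum_le_card_nsmul _ _ (C ^ 2) fun p _ => ?_).trans (by simp)
    refine (norm_avg_le _ n).trans (avg_le_const (by positivity) fun t => ?_)
    rw [norm_mul, RCLike.norm_conj, sq]
    exact mul_le_mul (hu _) (hu _) (norm_nonneg _) hC
  refine h1.trans ((le_abs_self _).trans ?_)
  rwa [Complex.norm_real] at h3

/-- Van der Corput's criterion: if all autocorrelations of a bounded array vanish in the limit, so
do its averages. -/
theorem tendsto_avg_of_correlation {l : Filter ℕ} (hl : l ≤ atTop) {u : ℕ → ℕ → ℂ} {C : ℝ}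
    (hu : ∀ n t, ‖u n t‖ ≤ C)
    (hcor : ∀ h h' : ℕ, h ≠ h' →
      Tendsto (fun n => avg (fun t => u n (t + h) * (starRingEnd ℂ) (u n (t + h'))) n) l (𝓝 0)) :
    Tendsto (fun n => avg (u n) n) l (𝓝 0) := by
  have hC : 0 ≤ C := (norm_nonneg _).trans (hu 0 0)
  rw [Metric.tendsto_nhds]
  intro ε hε
  -- The diagonal contributes `H * C ^ 2`, linear in `H`, against a target quadratic in `H`; this
  -- choice makes it smaller than `(H * (ε / 2)) ^ 2`.
  obtain ⟨H, hH⟩ := exists_nat_gt (max 0 (C ^ 2 / (ε / 2) ^ 2))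
  have hH0 : (0 : ℝ) < H := (le_max_left _ _).trans_lt hH
  have hHC : H * C ^ 2 < (H * (ε / 2)) ^ 2 := by
    have := (div_lt_iff₀ (by positivity)).1 ((le_max_right _ _).trans_lt hH)
    calc H * C ^ 2 < H * (H * (ε / 2) ^ 2) := by gcongr
      _ = _ := by ring
  have hlim : Tendsto (fun n => H * C ^ 2 + ∑ p ∈ (Finset.range H).offDiag,
      ‖avg (fun t => u n (t + p.1) * (starRingEnd ℂ) (u n (t + p.2))) n‖) l
      (𝓝 (H * C ^ 2 + 0)) := by
    refine tendsto_const_nhds.add ?_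
    rw [← Finset.sum_const_zero (s := (Finset.range H).offDiag)]
    refine tendsto_finsetSum _ fun p hp => ?_
    simpa using (hcor p.1 p.2 (by simpa using (Finset.mem_offDiag.1 hp).2.2)).norm
  rw [add_zero] at hlim
  have hsh := tendsto_natCast_inv_mul hl (∑ h ∈ Finset.range H, 2 * (h : ℝ) * C)
  filter_upwards [hlim.eventually_lt_const hHC,
    hsh.eventually_lt_const (show 0 < H * (ε / 2) by positivity)] with n h1 h2
  have h3 := (sq_norm_avg_le_van_der_corput hC (hu n) n).trans_lt h1
  have h4 := lt_of_pow_lt_pow_left₀ 2 (by positivity) h3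
  have h5 : ‖avg (fun t => ∑ h ∈ Finset.range H, u n (t + h)) n - H * avg (u n) n‖ ≤
      (n : ℝ)⁻¹ * ∑ h ∈ Finset.range H, 2 * (h : ℝ) * C := by
    have : (H : ℂ) * avg (u n) n = ∑ h ∈ Finset.range H, avg (u n) n := by simp
    rw [avg_sum, this, ← Finset.sum_sub_distrib, Finset.mul_sum]
    exact norm_sum_le_of_le _ fun h _ => norm_avg_shift_sub_le (hu n) h n
  have h6 : H * ‖avg (u n) n‖ < H * ε := by
    calc H * ‖avg (u n) n‖ = ‖(H : ℂ) * avg (u n) n‖ := by simp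
      _ ≤ ‖avg (fun t => ∑ h ∈ Finset.range H, u n (t + h)) n‖ +
          ‖avg (fun t => ∑ h ∈ Finset.range H, u n (t + h)) n - H * avg (u n) n‖ := by
        have := norm_sub_le (avg (fun t => ∑ h ∈ Finset.range H, u n (t + h)) n)
          (avg (fun t => ∑ h ∈ Finset.range H, u n (t + h)) n - H * avg (u n) n)
        simpa using this
      _ < H * (ε / 2) + H * (ε / 2) := add_lt_add h4 (h5.trans_lt h2)
      _ = H * ε := by ring
  simpa using lt_of_mul_lt_mul_left h6 hH0.le

/-! ### Quadratic phases and Weyl sums -/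

/-- The unit complex number `e^{i(β t² + γ t)}`. -/
noncomputable def phase (β γ : ℝ) (t : ℕ) : ℂ :=
  Complex.exp (((β * (t : ℝ) ^ 2 + γ * t : ℝ) : ℂ) * Complex.I)

@[simp] theorem norm_phase (β γ : ℝ) (t : ℕ) : ‖phase β γ t‖ = 1 :=
  Complex.norm_exp_ofReal_mul_I _

theorem phase_mul (β γ β' γ' : ℝ) (t : ℕ) :
    phase β γ t * phase β' γ' t = phase (β + β') (γ + γ') t := by
  simp only [phase, ← Complex.exp_add]
  congr 1; push_cast; ring

theorem conj_phase (β γ : ℝ) (t : ℕ) :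
    (starRingEnd ℂ) (phase β γ t) = phase (-β) (-γ) t := by
  simp only [phase, ← Complex.exp_conj, map_mul, Complex.conj_ofReal, Complex.conj_I]
  congr 1; push_cast; ring

@[simp] theorem phase_zero_zero (t : ℕ) : phase 0 0 t = 1 := by simp [phase]

/-- Differencing lowers the degree: the quadratic term cancels, and `γ` survives only in a
unimodular constant. -/
theorem phase_add_mul_conj (β γ : ℝ) (h h' t : ℕ) :
    phase β γ (t + h) * (starRingEnd ℂ) (phase β γ (t + h')) =
      Complex.exp (((β * ((h : ℝ) ^ 2 - (h' : ℝ) ^ 2) + γ * (h - h') : ℝ) : ℂ) * Complex.I) *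
        phase 0 (2 * β * (h - h')) t := by
  simp only [conj_phase]
  simp only [phase, ← Complex.exp_add]
  congr 1; push_cast; ring

theorem phase_linear (γ : ℝ) (t : ℕ) : phase 0 γ t = Complex.exp (γ * Complex.I) ^ t := by
  rw [phase, ← Complex.exp_nat_mul]
  congr 1; push_cast; ring

theorem norm_avg_phase_linear_le {γ : ℝ} (hγ : Complex.exp (γ * Complex.I) ≠ 1) (n : ℕ) :
    ‖avg (phase 0 γ) n‖ ≤ (n : ℝ)⁻¹ * (2 / ‖Complex.exp (γ * Complex.I) - 1‖) := by
  set w := Complex.exp (γ * Complex.I) with hw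
  have hw1 : ‖w‖ = 1 := Complex.norm_exp_ofReal_mul_I γ
  have : ∑ t ∈ Finset.Icc 1 n, phase 0 γ t = w * ((w ^ n - 1) / (w - 1)) := by
    rw [← geom_sum_eq hγ, Finset.mul_sum, Finset.range_eq_Ico]
    simp only [phase_linear, ← hw]
    rw [show Finset.Icc 1 n = Finset.Ico (0 + 1) (n + 1) from rfl,
      ← Finset.sum_Ico_add' (fun t => w ^ t) 0 n 1]
    exact Finset.sum_congr rfl fun t _ => by rw [pow_succ']
  rw [avg, this, norm_smul, norm_inv, Real.norm_natCast, norm_mul, norm_div, hw1, one_mul]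
  gcongr
  refine (norm_sub_le _ _).trans ?_
  simp [hw1]; norm_num

/-- Averages of linear phases vanish if the frequency stays away from the multiples of `2π`. -/
theorem tendsto_avg_phase_linear {l : Filter ℕ} (hl : l ≤ atTop) {γ : ℕ → ℝ} {γ' : ℝ}
    (hγ : Tendsto γ l (𝓝 γ')) (hγ' : Complex.exp (γ' * Complex.I) ≠ 1) :
    Tendsto (fun n => avg (phase 0 (γ n)) n) l (𝓝 0) := by
  have hlim : Tendsto (fun n => Complex.exp (γ n * Complex.I)) l
      (𝓝 (Complex.exp (γ' * Complex.I))) := by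
    have : Continuous fun x : ℝ => Complex.exp (x * Complex.I) := by fun_prop
    exact (this.tendsto γ').comp hγ
  have h2 := ((hlim.sub_const 1).norm.inv₀ (by simpa [sub_eq_zero] using hγ')).const_mul 2
  have h3 := ((tendsto_inv_atTop_nhds_zero_nat (𝕜 := ℝ)).mono_left hl).mul h2
  rw [zero_mul] at h3
  refine squeeze_zero_norm' ?_ h3
  filter_upwards [hlim.eventually_ne hγ'] with n hn
  exact (norm_avg_phase_linear_le hn n)

theorem exp_mul_I_ne_one_of_irrational {β : ℝ} (hβ : Irrational (β / Real.pi)) {k : ℤ}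
    (hk : k ≠ 0) : Complex.exp ((β * k : ℝ) * Complex.I) ≠ 1 := by
  intro h
  obtain ⟨m, hm⟩ := Complex.exp_eq_one_iff.1 h
  have h1 : β * k = m * (2 * Real.pi) := by
    have : ((β * k : ℝ) : ℂ) * Complex.I = ((m * (2 * Real.pi) : ℝ) : ℂ) * Complex.I := by
      rw [hm]; push_cast; ring
    exact_mod_cast mul_right_cancel₀ Complex.I_ne_zero this
  refine hβ ⟨2 * m / k, ?_⟩
  have hk' : (k : ℝ) ≠ 0 := by exact_mod_cast hk
  have := Real.pi_ne_zero
  push_cast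
  field_simp
  linarith

/-- Weyl's theorem, uniformly in the linear coefficient. -/
theorem tendsto_avg_phase {l : Filter ℕ} (hl : l ≤ atTop) {β γ : ℕ → ℝ} {β' : ℝ}
    (hβ : Tendsto β l (𝓝 β')) (hβ' : Irrational (β' / Real.pi)) :
    Tendsto (fun n => avg (phase (β n) (γ n)) n) l (𝓝 0) := by
  -- The norm of a correlation does not depend on `γ`, so no convergence of `γ` is needed.
  refine tendsto_avg_of_correlation hl (C := 1) (fun n t => (norm_phase _ _ _).le) ?_
  intro h h' hne
  have hk : (2 * ((h : ℤ) - h') : ℤ) ≠ 0 := by omega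
  have := tendsto_avg_phase_linear hl (γ := fun n => 2 * β n * ((h : ℝ) - h'))
    ((hβ.const_mul 2).mul_const _) (γ' := 2 * β' * ((h : ℝ) - h')) (by
      have := exp_mul_I_ne_one_of_irrational hβ' hk
      convert this using 4
      push_cast; ring)
  refine squeeze_zero_norm (fun n => le_of_eq ?_) (by simpa using this.norm)
  simp only [phase_add_mul_conj]
  rw [avg_const_mul, norm_mul, Complex.norm_exp_ofReal_mul_I, one_mul]

/-! ### Waveforms close in mean square -/

theorem tendsto_zero_of_sq {l : Filter ℕ} {f : ℕ → ℝ}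
    (h : Tendsto (fun n => f n ^ 2) l (𝓝 0)) : Tendsto f l (𝓝 0) := by
  have := h.sqrt
  simp only [Real.sqrt_zero, Real.sqrt_sq_eq_abs] at this
  exact (tendsto_zero_iff_abs_tendsto_zero _).2 this

theorem tendsto_avg_norm_of_sq {l : Filter ℕ} {v : ℕ → ℕ → ℂ}
    (h : Tendsto (fun n => avg (fun t => ‖v n t‖ ^ 2) n) l (𝓝 0)) :
    Tendsto (fun n => avg (fun t => ‖v n t‖) n) l (𝓝 0) :=
  tendsto_zero_of_sq <| squeeze_zero (fun _ => sq_nonneg _) (fun n => sq_avg_le _ n) h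

/-- Lets a mean-square null sequence be tested against a fixed phase: its Fourier coefficient
vanishes in the limit. -/
theorem tendsto_avg_mul_phase_of_sq {l : Filter ℕ} {g : ℕ → ℕ → ℝ}
    (h : Tendsto (fun n => avg (fun t => g n t ^ 2) n) l (𝓝 0)) (β γ : ℝ) :
    Tendsto (fun n => avg (fun t => (g n t : ℂ) * phase β γ t) n) l (𝓝 0) := by
  refine squeeze_zero_norm (fun n => norm_avg_le _ n)
    (tendsto_avg_norm_of_sq (v := fun n t => (g n t : ℂ) * phase β γ t) ?_)
  simpa using h

theorem tendsto_avg_const_mul {l : Filter ℕ} {c : ℕ → ℂ} {c' x : ℂ} {u : ℕ → ℕ → ℂ}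
    (hc : Tendsto c l (𝓝 c')) (hu : Tendsto (fun n => avg (u n) n) l (𝓝 x)) :
    Tendsto (fun n => avg (fun t => c n * u n t) n) l (𝓝 (c' * x)) := by
  simp only [avg_const_mul]
  exact hc.mul hu

theorem tendsto_conj {l : Filter ℕ} {c : ℕ → ℂ} {c' : ℂ} (hc : Tendsto c l (𝓝 c')) :
    Tendsto (fun n => (starRingEnd ℂ) (c n)) l (𝓝 ((starRingEnd ℂ) c')) :=
  (Complex.continuous_conj.tendsto c').comp hc

/-- The real part is half the sum of the waveform and its conjugate; `x` and `y` record whether each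
of the two resonates with the test phase. -/
theorem tendsto_avg_re_mul_phase {l : Filter ℕ} {c : ℕ → ℂ} {c' x y : ℂ}
    (hc : Tendsto c l (𝓝 c')) {β γ : ℕ → ℝ} {β₁ γ₁ : ℝ}
    (hx : Tendsto (fun n => avg (phase (β n + β₁) (γ n + γ₁)) n) l (𝓝 x))
    (hy : Tendsto (fun n => avg (phase (-β n + β₁) (-γ n + γ₁)) n) l (𝓝 y)) :
    Tendsto (fun n => avg (fun t => ((c n * phase (β n) (γ n) t).re : ℂ) * phase β₁ γ₁ t) n) l
      (𝓝 (c' / 2 * x + (starRingEnd ℂ) c' / 2 * y)) := by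
  have h1 := tendsto_avg_const_mul (hc.div_const 2) hx
  have h2 := tendsto_avg_const_mul ((tendsto_conj hc).div_const 2) hy
  refine (h1.add h2).congr fun n => ?_
  rw [← avg_add]
  refine avg_congr fun t => ?_
  rw [Complex.re_eq_add_conj, map_mul, conj_phase, ← phase_mul, ← phase_mul]
  ring

theorem re_mul_re (p q : ℂ) :
    p.re * q.re = (p * q).re / 2 + (p * (starRingEnd ℂ) q).re / 2 := by
  simp [Complex.mul_re]; ring

theorem avg_re (u : ℕ → ℂ) (n : ℕ) : avg (fun t => (u t).re) n = (avg u n).re :=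
  (map_avg Complex.reCLM u n).symm

theorem tendsto_avg_re_mul_re {l : Filter ℕ} {a c : ℕ → ℂ} {a' c' : ℂ}
    (ha : Tendsto a l (𝓝 a')) (hc : Tendsto c l (𝓝 c')) {β γ β₁ γ₁ : ℕ → ℝ}
    (hx : Tendsto (fun n => avg (phase (β n + β₁ n) (γ n + γ₁ n)) n) l (𝓝 0))
    (hy : Tendsto (fun n => avg (phase (β n + -β₁ n) (γ n + -γ₁ n)) n) l (𝓝 0)) :
    Tendsto (fun n => avg (fun t => (a n * phase (β n) (γ n) t).re *
      (c n * phase (β₁ n) (γ₁ n) t).re) n) l (𝓝 0) := by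
  have h1 := tendsto_avg_const_mul ((ha.mul hc).div_const 2) hx
  have h2 := tendsto_avg_const_mul ((ha.mul (tendsto_conj hc)).div_const 2) hy
  have h3 := (Complex.continuous_re.tendsto _).comp (h1.add h2)
  simp only [mul_zero, add_zero, Complex.zero_re] at h3
  refine h3.congr fun n => ?_
  rw [Function.comp_apply, ← avg_add, ← avg_re]
  refine avg_congr fun t => ?_
  have e : ∀ z : ℂ, z.re / 2 = (z / 2).re := fun z => by
    rw [← Complex.div_ofNat_re]
  rw [re_mul_re, map_mul, conj_phase, ← phase_mul, ← phase_mul, e, e, ← Complex.add_re]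
  congr 1; ring

/-- Recovers the modulus from the real part when averages of `v ^ 2` vanish. -/
theorem sq_norm_eq_two_mul_re_sq_sub (v : ℂ) : ‖v‖ ^ 2 = 2 * v.re ^ 2 - (v ^ 2).re := by
  rw [Complex.sq_norm, Complex.normSq_apply, sq v, Complex.mul_re]; ring

/-- A small real part of the difference of two waveforms makes the waveforms close, unless they
resonate. -/
theorem tendsto_avg_norm_of_re {l : Filter ℕ} {a : ℕ → ℂ} {a' a₀ : ℂ}
    (ha : Tendsto a l (𝓝 a')) {β γ : ℕ → ℝ} {β₀ γ₀ : ℝ}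
    (h₁ : Tendsto (fun n => avg (phase (β n + β n) (γ n + γ n)) n) l (𝓝 0))
    (h₂ : Tendsto (fun n => avg (phase (β n + β₀) (γ n + γ₀)) n) l (𝓝 0))
    (h₃ : Tendsto (fun n => avg (phase (β₀ + β₀) (γ₀ + γ₀)) n) l (𝓝 0))
    (h : Tendsto (fun n => avg (fun t =>
      (a n * phase (β n) (γ n) t - a₀ * phase β₀ γ₀ t).re ^ 2) n) l (𝓝 0)) :
    Tendsto (fun n => avg (fun t =>
      ‖a n * phase (β n - β₀) (γ n - γ₀) t - a₀‖) n) l (𝓝 0) := by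
  -- The square contains only sums of frequencies, precisely the three assumed to average out.
  have hs : Tendsto (fun n => avg (fun t =>
      (a n * phase (β n) (γ n) t - a₀ * phase β₀ γ₀ t) ^ 2) n) l (𝓝 0) := by
    have := ((tendsto_avg_const_mul (ha.mul ha) h₁).sub
      (tendsto_avg_const_mul ((ha.mul_const a₀).const_mul 2) h₂)).add
      (tendsto_avg_const_mul (tendsto_const_nhds (x := a₀ ^ 2)) h₃)
    simp only [mul_zero, add_zero, sub_zero] at this
    refine this.congr fun n => ?_
    rw [← avg_sub, ← avg_add]
    refine avg_congr fun t => ?_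
    simp only [← phase_mul]
    ring
  have hn : Tendsto (fun n => avg (fun t =>
      ‖a n * phase (β n) (γ n) t - a₀ * phase β₀ γ₀ t‖ ^ 2) n) l (𝓝 0) := by
    have := (h.const_mul 2).sub ((Complex.continuous_re.tendsto _).comp hs)
    simp only [mul_zero, Complex.zero_re, sub_zero] at this
    refine this.congr fun n => ?_
    rw [Function.comp_apply, ← avg_re, ← avg_const_mul, ← avg_sub]
    exact avg_congr fun t => (sq_norm_eq_two_mul_re_sq_sub _).symm
  refine (tendsto_avg_norm_of_sq hn).congr fun n => avg_congr fun t => ?_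
  have : a n * phase (β n) (γ n) t - a₀ * phase β₀ γ₀ t =
      (a n * phase (β n - β₀) (γ n - γ₀) t - a₀) * phase β₀ γ₀ t := by
    have := phase_mul (β n - β₀) (γ n - γ₀) β₀ γ₀ t
    simp only [sub_add_cancel] at this
    rw [← this]; ring
  rw [this, norm_mul, norm_phase, mul_one]

/-! ### Amplitudes from dilations -/

theorem exists_norm_pow_sub_pow_le (C : ℝ) (k : ℕ) :
    ∃ L, 0 ≤ L ∧ ∀ x y : ℂ, ‖x‖ ≤ C → ‖y‖ ≤ C → ‖x ^ k - y ^ k‖ ≤ L * ‖x - y‖ := by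
  induction k with
  | zero => exact ⟨0, le_rfl, by simp⟩
  | succ k ih =>
    obtain ⟨L, hL, h⟩ := ih
    refine ⟨|C| * L + |C| ^ k, by positivity, fun x y hx hy => ?_⟩
    have hx' := hx.trans (le_abs_self C)
    have hy' := hy.trans (le_abs_self C)
    calc ‖x ^ (k + 1) - y ^ (k + 1)‖ = ‖x * (x ^ k - y ^ k) + y ^ k * (x - y)‖ := by
          congr 1; ring
      _ ≤ ‖x‖ * ‖x ^ k - y ^ k‖ + ‖y‖ ^ k * ‖x - y‖ := by
          refine (norm_add_le _ _).trans_eq ?_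
          rw [norm_mul, norm_mul, norm_pow]
      _ ≤ |C| * (L * ‖x - y‖) + |C| ^ k * ‖x - y‖ := by
          gcongr
          exact h x y hx hy
      _ = _ := by ring

theorem sum_dilate_le {g : ℕ → ℝ} (hg : ∀ t, 0 ≤ g t) {k : ℕ} (hk : 0 < k) (n : ℕ) :
    ∑ t ∈ Finset.Icc 1 (n / k), g (k * t) ≤ ∑ t ∈ Finset.Icc 1 n, g t := by
  rw [← Finset.sum_image (f := g) (g := fun t => k * t) (s := Finset.Icc 1 (n / k))
    fun x _ y _ h => Nat.eq_of_mul_eq_mul_left hk h]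
  refine Finset.sum_le_sum_of_subset_of_nonneg (fun x hx => ?_) fun t _ _ => hg t
  obtain ⟨t, ht, rfl⟩ := Finset.mem_image.1 hx
  rw [Finset.mem_Icc] at ht ⊢
  refine ⟨Nat.mul_pos hk ht.1, ?_⟩
  calc k * t ≤ k * (n / k) := Nat.mul_le_mul_left _ ht.2
    _ ≤ n := Nat.mul_div_le n k

/-- The amplitude of a waveform that is close to a constant is determined by a homogeneity
relation. -/
theorem pow_eq_pow_of_tendsto_avg {l : Filter ℕ} [l.NeBot] (hl : l ≤ atTop) {u : ℕ → ℕ → ℂ}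
    {z : ℕ → ℂ} {z' a : ℂ} (ha : a ≠ 0) {C : ℝ} (hu : ∀ᶠ n in l, ∀ t, ‖u n t‖ ≤ C)
    (hz : Tendsto z l (𝓝 z')) {k m : ℕ} (hk : 0 < k)
    (h : Tendsto (fun n => avg (fun t => ‖u n t - a‖) n) l (𝓝 0))
    (hhom : ∀ n t, z n ^ m * u n (k * t) = u n t ^ (m + 1)) : z' ^ m = a ^ m := by
  obtain ⟨L, hL, hLip⟩ := exists_norm_pow_sub_pow_le (max C ‖a‖) (m + 1)
  have hlim : Tendsto (fun n => ‖z n ^ m * a - a ^ (m + 1)‖) l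
      (𝓝 ‖z' ^ m * a - a ^ (m + 1)‖) := (((hz.pow m).mul_const a).sub_const _).norm
  have hbd : Tendsto (fun n => (‖z n ^ m‖ + L) * (2 * k) * avg (fun t => ‖u n t - a‖) n) l
      (𝓝 0) := by
    simpa using (((hz.pow m).norm.add_const L).mul_const (2 * (k : ℝ))).mul h
  have hle : ∀ᶠ n in l, ‖z n ^ m * a - a ^ (m + 1)‖ ≤
      (‖z n ^ m‖ + L) * (2 * k) * avg (fun t => ‖u n t - a‖) n := by
    filter_upwards [hu, (eventually_ge_atTop k).filter_mono hl] with n hn hnk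
    have hq : 1 ≤ n / k := Nat.div_pos hnk hk
    -- As `n ≥ k`, the multiples of `k` up to `n` form at least the fraction `1 / (2 * k)`, so
    -- closeness on average passes to them.
    have hnq : (n : ℝ) ≤ 2 * k * (n / k : ℕ) := by
      have h1 := Nat.div_add_mod n k
      have h2 := Nat.mod_lt n hk
      have h3 : k * 1 ≤ k * (n / k) := Nat.mul_le_mul_left _ hq
      have : n ≤ 2 * (k * (n / k)) := by omega
      rw [mul_assoc]
      exact_mod_cast this
    have hn0 : (0 : ℝ) < n := by exact_mod_cast hk.trans_le hnk
    -- `a` is compared with `u n (k * t)` and `a ^ (m + 1)` with `u n t ^ (m + 1)`, which `hhom`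
    -- links.
    have hpt : ∀ t, ‖z n ^ m * a - a ^ (m + 1)‖ ≤
        ‖z n ^ m‖ * ‖u n (k * t) - a‖ + L * ‖u n t - a‖ := by
      intro t
      calc ‖z n ^ m * a - a ^ (m + 1)‖
          = ‖(u n t ^ (m + 1) - a ^ (m + 1)) - z n ^ m * (u n (k * t) - a)‖ := by
            rw [← hhom]; congr 1; ring
        _ ≤ L * ‖u n t - a‖ + ‖z n ^ m‖ * ‖u n (k * t) - a‖ := by
            refine (norm_sub_le _ _).trans (add_le_add ?_ (norm_mul_le _ _))
            exact hLip _ _ ((hn t).trans (le_max_left _ _)) (le_max_right _ _)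
        _ = _ := add_comm _ _
    have hsum : (n / k : ℕ) * ‖z n ^ m * a - a ^ (m + 1)‖ ≤
        (‖z n ^ m‖ + L) * ∑ t ∈ Finset.Icc 1 n, ‖u n t - a‖ := by
      calc (n / k : ℕ) * ‖z n ^ m * a - a ^ (m + 1)‖
          = ∑ t ∈ Finset.Icc 1 (n / k), ‖z n ^ m * a - a ^ (m + 1)‖ := by simp
        _ ≤ ∑ t ∈ Finset.Icc 1 (n / k),
            (‖z n ^ m‖ * ‖u n (k * t) - a‖ + L * ‖u n t - a‖) :=
            Finset.sum_le_sum fun t _ => hpt t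
        _ = ‖z n ^ m‖ * ∑ t ∈ Finset.Icc 1 (n / k), ‖u n (k * t) - a‖ +
            L * ∑ t ∈ Finset.Icc 1 (n / k), ‖u n t - a‖ := by
            rw [Finset.sum_add_distrib, Finset.mul_sum, Finset.mul_sum]
        _ ≤ ‖z n ^ m‖ * ∑ t ∈ Finset.Icc 1 n, ‖u n t - a‖ +
            L * ∑ t ∈ Finset.Icc 1 n, ‖u n t - a‖ := by
            gcongr
            · exact sum_dilate_le (g := fun t => ‖u n t - a‖) (fun _ => norm_nonneg _) hk n
            · exact Nat.div_le_self n k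
        _ = _ := by ring
    have hS : ∑ t ∈ Finset.Icc 1 n, ‖u n t - a‖ = n * avg (fun t => ‖u n t - a‖) n := by
      simp only [avg, smul_eq_mul]
      field_simp
    rw [hS] at hsum
    have h4 : 0 ≤ ‖z n ^ m * a - a ^ (m + 1)‖ := norm_nonneg _
    refine le_of_mul_le_mul_left ?_ hn0
    calc (n : ℝ) * ‖z n ^ m * a - a ^ (m + 1)‖
        ≤ 2 * k * (n / k : ℕ) * ‖z n ^ m * a - a ^ (m + 1)‖ := by gcongr
      _ = 2 * k * ((n / k : ℕ) * ‖z n ^ m * a - a ^ (m + 1)‖) := by ring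
      _ ≤ 2 * k * ((‖z n ^ m‖ + L) * (n * avg (fun t => ‖u n t - a‖) n)) := by gcongr
      _ = _ := by ring
  have h0 : ‖z' ^ m * a - a ^ (m + 1)‖ = 0 :=
    le_antisymm (le_of_tendsto_of_tendsto hlim hbd hle) (norm_nonneg _)
  rw [norm_eq_zero, sub_eq_zero, pow_succ] at h0
  exact mul_right_cancel₀ ha h0

theorem eventually_norm_mul_phase_le {l : Filter ℕ} {a : ℕ → ℂ} {a' : ℂ}
    (ha : Tendsto a l (𝓝 a')) (β γ : ℕ → ℝ) :
    ∀ᶠ n in l, ∀ t, ‖a n * phase (β n) (γ n) t‖ ≤ ‖a'‖ + 1 := by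
  filter_upwards [ha.norm.eventually_lt_const (lt_add_one ‖a'‖)] with n hn t
  simpa using hn.le

/-- With `u t = z * w ^ t` one has `z * u (2 * t) = u t ^ 2`. Nothing is needed about the
frequencies. -/
theorem eq_of_tendsto_avg_linear {l : Filter ℕ} [l.NeBot] (hl : l ≤ atTop) {a : ℕ → ℂ}
    {a' a₀ : ℂ} (ha : Tendsto a l (𝓝 a')) (ha₀ : a₀ ≠ 0) {γ : ℕ → ℝ}
    (h : Tendsto (fun n => avg (fun t => ‖a n * phase 0 (γ n) t - a₀‖) n) l (𝓝 0)) :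
    a' = a₀ := by
  have := pow_eq_pow_of_tendsto_avg hl (m := 1) (k := 2) ha₀
    (eventually_norm_mul_phase_le ha (fun _ => 0) γ) ha two_pos h fun n t => by
      simp only [phase_linear, pow_mul]; ring
  simpa using this

theorem phase_quadratic (β : ℝ) (t : ℕ) :
    phase β 0 t = Complex.exp (β * Complex.I) ^ (t ^ 2) := by
  rw [phase, ← Complex.exp_nat_mul]
  congr 1; push_cast; ring

/-- With `u t = z * w ^ (t ^ 2)`, dilation by 2 and by 3 gives `z ^ 3 * u (2 * t) = u t ^ 4` and `z
^ 8 * u (3 * t) = u t ^ 9`. The frequency then follows from the linear case applied to the lag-one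
correlation. -/
theorem eq_of_tendsto_avg_quadratic {l : Filter ℕ} [l.NeBot] (hl : l ≤ atTop) {c : ℕ → ℂ}
    {c' c₀ : ℂ} (hc : Tendsto c l (𝓝 c')) (hc₀ : c₀ ≠ 0) {β : ℕ → ℝ} {β' : ℝ}
    (hβ : Tendsto β l (𝓝 β'))
    (h : Tendsto (fun n => avg (fun t => ‖c n * phase (β n) 0 t - c₀‖) n) l (𝓝 0)) :
    c' = c₀ ∧ Complex.exp (β' * Complex.I) = 1 := by
  have hbd := eventually_norm_mul_phase_le hc β fun _ => 0
  have h3 := pow_eq_pow_of_tendsto_avg hl (m := 3) (k := 2) hc₀ hbd hc two_pos h fun n t => by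
    simp only [phase_quadratic]; ring
  have h8 := pow_eq_pow_of_tendsto_avg hl (m := 8) (k := 3) hc₀ hbd hc three_pos h fun n t => by
    simp only [phase_quadratic]; ring
  have hcc : c' = c₀ := by
    -- The exponents 3 and 8 are coprime: `3 * 3 = 8 + 1`.
    refine mul_right_cancel₀ (pow_ne_zero 8 hc₀) ?_
    rw [← h8, ← pow_succ', show c' ^ (8 + 1) = (c' ^ 3) ^ 3 by ring, h3, h8]; ring
  refine ⟨hcc, ?_⟩
  subst hcc
  -- The lag-one correlation is a linear phase with amplitude `|c n| ^ 2 * exp (i * β n)`, and it is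
  -- close on average to `|c'| ^ 2`.
  have hlim : Tendsto (fun n => c n * (starRingEnd ℂ) (c n) * Complex.exp (β n * Complex.I)) l
      (𝓝 (c' * (starRingEnd ℂ) c' * Complex.exp (β' * Complex.I))) := by
    refine (hc.mul (tendsto_conj hc)).mul ?_
    have : Continuous fun x : ℝ => Complex.exp (x * Complex.I) := by fun_prop
    exact (this.tendsto β').comp hβ
  have hne : c' * (starRingEnd ℂ) c' ≠ 0 := mul_ne_zero hc₀ ((map_ne_zero _).2 hc₀)
  have hpt : ∀ n t, c n * (starRingEnd ℂ) (c n) * Complex.exp (β n * Complex.I) *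
      phase 0 (2 * β n) t =
      c n * phase (β n) 0 (t + 1) * (starRingEnd ℂ) (c n * phase (β n) 0 t) := by
    intro n t
    have := phase_add_mul_conj (β n) 0 1 0 t
    rw [Nat.cast_one, Nat.cast_zero, add_zero,
      show β n * ((1 : ℝ) ^ 2 - 0 ^ 2) + 0 * (1 - 0) = β n by ring,
      show 2 * β n * ((1 : ℝ) - 0) = 2 * β n by ring] at this
    calc _ = c n * (starRingEnd ℂ) (c n) *
          (phase (β n) 0 (t + 1) * (starRingEnd ℂ) (phase (β n) 0 t)) := by
          rw [this]; ring
      _ = _ := by rw [map_mul]; ring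
  have hlin : Tendsto (fun n => avg (fun t =>
      ‖c n * (starRingEnd ℂ) (c n) * Complex.exp (β n * Complex.I) * phase 0 (2 * β n) t -
        c' * (starRingEnd ℂ) c'‖) n) l (𝓝 0) := by
    have hsh : Tendsto (fun n => avg (fun t => ‖c n * phase (β n) 0 (t + 1) - c'‖) n) l
        (𝓝 0) := by
      have h1 := h.add (tendsto_natCast_inv_mul hl (2 * (1 : ℕ) * (‖c'‖ + 1 + ‖c'‖)))
      rw [add_zero] at h1
      refine squeeze_zero' (Eventually.of_forall fun n => avg_nonneg fun t => norm_nonneg _) ?_ h1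
      filter_upwards [hbd] with n hn
      have h2 := norm_avg_shift_sub_le (u := fun t => ‖c n * phase (β n) 0 t - c'‖)
        (C := ‖c'‖ + 1 + ‖c'‖) (fun t => by
          rw [norm_norm]
          exact (norm_sub_le _ _).trans (add_le_add_left (hn t) _)) 1 n
      have h3 := (le_abs_self _).trans h2
      linarith
    have h4 := (hsh.const_mul (‖c'‖ + 1)).add (h.const_mul ‖c'‖)
    simp only [mul_zero, add_zero] at h4
    refine squeeze_zero' (Eventually.of_forall fun n => avg_nonneg fun t => norm_nonneg _) ?_ h4
    filter_upwards [hbd] with n hn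
    rw [← avg_const_mul, ← avg_const_mul, ← avg_add]
    refine avg_mono fun t => ?_
    rw [hpt]
    set x := c n * phase (β n) 0 (t + 1)
    set y := c n * phase (β n) 0 t
    calc ‖x * (starRingEnd ℂ) y - c' * (starRingEnd ℂ) c'‖
        = ‖(x - c') * (starRingEnd ℂ) y + c' * (starRingEnd ℂ) (y - c')‖ := by
          congr 1; rw [map_sub]; ring
      _ ≤ ‖x - c'‖ * ‖y‖ + ‖c'‖ * ‖y - c'‖ := by
          refine (norm_add_le _ _).trans_eq ?_
          rw [norm_mul, norm_mul, RCLike.norm_conj, RCLike.norm_conj]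
      _ ≤ (‖c'‖ + 1) * ‖x - c'‖ + ‖c'‖ * ‖y - c'‖ := by
          rw [mul_comm]
          gcongr
          exact hn t
  have := eq_of_tendsto_avg_linear hl hlim hne hlin
  exact mul_left_cancel₀ hne (by rw [this, mul_one])

/-! ### Identifiability of the parameters -/

theorem exp_mul_I_ne_one {x : ℝ} (h₁ : -(2 * Real.pi) < x) (h₂ : x < 2 * Real.pi) (h₀ : x ≠ 0) :
    Complex.exp (x * Complex.I) ≠ 1 := by
  intro h
  have := congrArg Complex.re h
  rw [Complex.exp_ofReal_mul_I_re, Complex.one_re] at this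
  exact h₀ ((Real.cos_eq_one_iff_of_lt_of_lt h₁ h₂).1 this)

theorem tendsto_avg_phase_zero {l : Filter ℕ} (hl : l ≤ atTop) {β γ : ℝ} (hβ : β = 0)
    (hγ : γ = 0) : Tendsto (fun n => avg (phase β γ) n) l (𝓝 1) := by
  subst hβ hγ
  refine tendsto_const_nhds.congr' ?_
  filter_upwards [(eventually_ne_atTop 0).filter_mono hl] with n hn
  rw [avg_congr phase_zero_zero, avg_const hn]

theorem tendsto_avg_phase_linear' {l : Filter ℕ} (hl : l ≤ atTop) {β γ : ℕ → ℝ} {γ' : ℝ}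
    (hβ : ∀ n, β n = 0) (hγ : Tendsto γ l (𝓝 γ')) (h₁ : -(2 * Real.pi) < γ')
    (h₂ : γ' < 2 * Real.pi) (h₀ : γ' ≠ 0) :
    Tendsto (fun n => avg (phase (β n) (γ n)) n) l (𝓝 0) := by
  simp only [hβ]
  exact tendsto_avg_phase_linear hl hγ (exp_mul_I_ne_one h₁ h₂ h₀)

theorem irrational_two_mul_div_pi {x : ℝ} (h : Irrational (x / Real.pi)) :
    Irrational ((x + x) / Real.pi) := by
  have := h.natCast_mul (m := 2) two_ne_zero
  convert this using 1
  push_cast; ring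

theorem irrational_neg_div_pi {x : ℝ} (h : Irrational (x / Real.pi)) :
    Irrational (-x / Real.pi) := by
  rw [neg_div]; exact h.neg

theorem tendsto_avg_sq_of_add {l : Filter ℕ} {f g : ℕ → ℕ → ℝ}
    (hfg : Tendsto (fun n => avg (fun t => f n t * g n t) n) l (𝓝 0))
    (h : Tendsto (fun n => avg (fun t => (f n t + g n t) ^ 2) n) l (𝓝 0)) :
    Tendsto (fun n => avg (fun t => f n t ^ 2) n) l (𝓝 0) ∧
      Tendsto (fun n => avg (fun t => g n t ^ 2) n) l (𝓝 0) := by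
  have h1 := h.sub (hfg.const_mul 2)
  simp only [mul_zero, sub_zero] at h1
  have h2 : ∀ n, avg (fun t => (f n t + g n t) ^ 2) n - 2 * avg (fun t => f n t * g n t) n =
      avg (fun t => f n t ^ 2) n + avg (fun t => g n t ^ 2) n := by
    intro n
    rw [← avg_const_mul, ← avg_sub, ← avg_add]
    exact avg_congr fun t => by ring
  simp only [h2] at h1
  have hf : ∀ n, 0 ≤ avg (fun t => f n t ^ 2) n := fun n => avg_nonneg fun t => sq_nonneg _
  have hg : ∀ n, 0 ≤ avg (fun t => g n t ^ 2) n := fun n => avg_nonneg fun t => sq_nonneg _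
  exact ⟨squeeze_zero hf (fun n => by linarith [hg n]) h1,
    squeeze_zero hg (fun n => by linarith [hf n]) h1⟩

/-- The limit of the chirp rates is not a rational multiple of `π`. -/
theorem irrational_of_tendsto_avg_sq {l : Filter ℕ} [l.NeBot] (hl : l ≤ atTop) {a c : ℕ → ℂ}
    {a' c' a₀ c₀ : ℂ} (ha : Tendsto a l (𝓝 a')) (hc : Tendsto c l (𝓝 c')) (hc₀ : c₀ ≠ 0)
    {α β : ℕ → ℝ} {β' α₀ β₀ : ℝ} (hβ : Tendsto β l (𝓝 β')) (hβ₀ : Irrational (β₀ / Real.pi))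
    (h : Tendsto (fun n => avg (fun t =>
      (((a n * phase 0 (α n) t).re - (a₀ * phase 0 α₀ t).re) +
        ((c n * phase (β n) 0 t).re - (c₀ * phase β₀ 0 t).re)) ^ 2) n) l (𝓝 0)) :
    Irrational (β' / Real.pi) := by
  by_contra hβ'
  rw [Irrational, not_not] at hβ'
  obtain ⟨q, hq⟩ := hβ'
  have hneg := irrational_neg_div_pi hβ₀
  -- Test against `phase (-β₀) 0`. If `β'` is a rational multiple of `π`, adding `±β'` or `0` to
  -- `-β₀` stays irrational relative to `π`, so `h1`, `h2` and `h3` have limit zero.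
  have h1 := tendsto_avg_re_mul_phase ha (β := fun _ => 0) (γ := α) (β₁ := -β₀) (γ₁ := 0)
    (tendsto_avg_phase hl tendsto_const_nhds (by simpa using hneg))
    (tendsto_avg_phase hl tendsto_const_nhds (by simpa using hneg))
  have h2 := tendsto_avg_re_mul_phase (l := l) (tendsto_const_nhds (x := a₀)) (β := fun _ => 0)
    (γ := fun _ => α₀) (β₁ := -β₀) (γ₁ := 0)
    (tendsto_avg_phase hl tendsto_const_nhds (by simpa using hneg))
    (tendsto_avg_phase hl tendsto_const_nhds (by simpa using hneg))
  have h3 := tendsto_avg_re_mul_phase hc (β := β) (γ := fun _ => 0) (β₁ := -β₀) (γ₁ := 0)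
    (tendsto_avg_phase hl (hβ.add_const _) (by
      rw [add_div, ← hq]; exact hneg.ratCast_add q))
    (tendsto_avg_phase hl (hβ.neg.add_const _) (by
      rw [add_div, neg_div, ← hq]
      have := hneg.ratCast_add (-q)
      rwa [Rat.cast_neg] at this))
  -- The only resonance: its limit is `c₀ / 2`, which is thereby forced to vanish.
  have h4 := tendsto_avg_re_mul_phase (l := l) (tendsto_const_nhds (x := c₀))
    (β := fun _ => β₀) (γ := fun _ => 0) (β₁ := -β₀) (γ₁ := 0)
    (tendsto_avg_phase_zero hl (add_neg_cancel _) (add_zero _))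
    (tendsto_avg_phase hl tendsto_const_nhds (irrational_two_mul_div_pi hneg))
  have h5 := tendsto_avg_mul_phase_of_sq h (-β₀) 0
  have h6 := (h1.sub h2).add (h3.sub h4)
  have h7 := tendsto_nhds_unique h5 (h6.congr fun n => by
    rw [← avg_sub, ← avg_sub, ← avg_add]
    refine avg_congr fun t => ?_
    push_cast; ring)
  simp at h7
  exact hc₀ h7

/-- Testing at `α₀` identifies the frequency, and dilation then gives the amplitude. As `α₀` is
interior, `α' + α₀` lies strictly between `0` and `2π`, which excludes aliasing. -/
theorem eq_of_tendsto_avg_linear_sq {l : Filter ℕ} [l.NeBot] (hl : l ≤ atTop) {a : ℕ → ℂ}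
    {a' a₀ : ℂ} (ha : Tendsto a l (𝓝 a')) (ha₀ : a₀ ≠ 0) {α : ℕ → ℝ} {α' α₀ : ℝ}
    (hα : Tendsto α l (𝓝 α')) (hα' : α' ∈ Set.Icc 0 Real.pi) (hα₀ : α₀ ∈ Set.Ioo 0 Real.pi)
    (h : Tendsto (fun n => avg (fun t =>
      ((a n * phase 0 (α n) t).re - (a₀ * phase 0 α₀ t).re) ^ 2) n) l (𝓝 0)) :
    a' = a₀ ∧ α' = α₀ := by
  obtain ⟨h0, h1⟩ := hα'
  obtain ⟨h2, h3⟩ := hα₀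
  have hαα : α' = α₀ := by
    by_contra hne
    have h4 := tendsto_avg_re_mul_phase ha (β := fun _ => 0) (γ := α) (β₁ := 0) (γ₁ := -α₀)
      (tendsto_avg_phase_linear' hl (fun _ => add_zero _) (hα.add_const _) (by linarith)
        (by linarith) (by rwa [← sub_eq_add_neg, sub_ne_zero]))
      (tendsto_avg_phase_linear' hl (fun _ => by simp) (hα.neg.add_const _) (by linarith)
        (by linarith) (by linarith))
    have h5 := tendsto_avg_re_mul_phase (l := l) (tendsto_const_nhds (x := a₀))
      (β := fun _ => 0) (γ := fun _ => α₀) (β₁ := 0) (γ₁ := -α₀)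
      (tendsto_avg_phase_zero hl (add_zero _) (add_neg_cancel _))
      (tendsto_avg_phase_linear' hl (fun _ => by simp) tendsto_const_nhds (by linarith)
        (by linarith) (by linarith))
    have h7 := tendsto_nhds_unique (tendsto_avg_mul_phase_of_sq h 0 (-α₀))
      ((h4.sub h5).congr fun n => by
        rw [← avg_sub]
        refine avg_congr fun t => ?_
        push_cast; ring)
    simp at h7
    exact ha₀ h7
  subst hαα
  refine ⟨?_, rfl⟩
  have := tendsto_avg_norm_of_re ha (β := fun _ => 0) (β₀ := 0) (γ := α) (γ₀ := α') (a₀ := a₀)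
    (tendsto_avg_phase_linear' hl (fun _ => add_zero _) (hα.add hα) (by linarith)
      (by linarith) (by linarith))
    (tendsto_avg_phase_linear' hl (fun _ => add_zero _) (hα.add_const _) (by linarith)
      (by linarith) (by linarith))
    (tendsto_avg_phase_linear' hl (fun _ => add_zero _) tendsto_const_nhds (by linarith)
      (by linarith) (by linarith)) (by simpa only [Complex.sub_re] using h)
  simp only [sub_zero] at this
  exact eq_of_tendsto_avg_linear hl ha ha₀ this

theorem eq_of_tendsto_avg_quadratic_sq {l : Filter ℕ} [l.NeBot] (hl : l ≤ atTop) {c : ℕ → ℂ}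
    {c' c₀ : ℂ} (hc : Tendsto c l (𝓝 c')) (hc₀ : c₀ ≠ 0) {β : ℕ → ℝ} {β' β₀ : ℝ}
    (hβ : Tendsto β l (𝓝 β')) (hβ' : Irrational (β' / Real.pi))
    (hβ₀ : Irrational (β₀ / Real.pi)) (hadd : Irrational ((β' + β₀) / Real.pi))
    (h : Tendsto (fun n => avg (fun t =>
      ((c n * phase (β n) 0 t).re - (c₀ * phase β₀ 0 t).re) ^ 2) n) l (𝓝 0)) :
    c' = c₀ ∧ Complex.exp ((β' - β₀ : ℝ) * Complex.I) = 1 := by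
  have := tendsto_avg_norm_of_re hc (β := β) (β₀ := β₀) (γ := fun _ => 0) (γ₀ := 0) (a₀ := c₀)
    (tendsto_avg_phase hl (hβ.add hβ) (irrational_two_mul_div_pi hβ'))
    (tendsto_avg_phase hl (hβ.add_const _) hadd)
    (tendsto_avg_phase hl tendsto_const_nhds (irrational_two_mul_div_pi hβ₀))
    (by simpa only [Complex.sub_re] using h)
  simp only [sub_zero] at this
  exact eq_of_tendsto_avg_quadratic hl hc hc₀ (hβ.sub_const β₀) this

/-- Identifiability: waveforms that are asymptotically close in mean square have the same limiting
parameters. -/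
theorem eq_of_tendsto_avg_sq {l : Filter ℕ} [l.NeBot] (hl : l ≤ atTop) {a c : ℕ → ℂ}
    {a' c' a₀ c₀ : ℂ} (ha : Tendsto a l (𝓝 a')) (hc : Tendsto c l (𝓝 c')) (ha₀ : a₀ ≠ 0)
    (hc₀ : c₀ ≠ 0) {α β : ℕ → ℝ} {α' β' α₀ β₀ : ℝ} (hα : Tendsto α l (𝓝 α'))
    (hβ : Tendsto β l (𝓝 β')) (hα' : α' ∈ Set.Icc 0 Real.pi) (hβ' : β' ∈ Set.Icc 0 Real.pi)
    (hα₀ : α₀ ∈ Set.Ioo 0 Real.pi) (hβ₀ : β₀ ∈ Set.Ioo 0 Real.pi)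
    (hirr₀ : Irrational (β₀ / Real.pi))
    (h : Tendsto (fun n => avg (fun t =>
      (((a n * phase 0 (α n) t).re - (a₀ * phase 0 α₀ t).re) +
        ((c n * phase (β n) 0 t).re - (c₀ * phase β₀ 0 t).re)) ^ 2) n) l (𝓝 0)) :
    a' = a₀ ∧ α' = α₀ ∧ c' = c₀ ∧ β' = β₀ := by
  have hirr := irrational_of_tendsto_avg_sq hl ha hc hc₀ hβ hirr₀ h
  -- A sinusoid times a chirp keeps a quadratic coefficient `±δ`, so Weyl's theorem makes the two
  -- components asymptotically orthogonal.
  have cross : ∀ {x z : ℕ → ℂ} {x' z' : ℂ} (hx : Tendsto x l (𝓝 x')) (hz : Tendsto z l (𝓝 z'))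
      (γ : ℕ → ℝ) {δ : ℕ → ℝ} {δ' : ℝ} (hδ : Tendsto δ l (𝓝 δ'))
      (hδ' : Irrational (δ' / Real.pi)),
      Tendsto (fun n => avg (fun t => (x n * phase 0 (γ n) t).re *
        (z n * phase (δ n) 0 t).re) n) l (𝓝 0) := by
    intro x z x' z' hx hz γ δ δ' hδ hδ'
    refine tendsto_avg_re_mul_re hx hz (β := fun _ => 0) (γ₁ := fun _ => 0) ?_ ?_
    · simp only [zero_add]
      exact tendsto_avg_phase hl hδ hδ'
    · simp only [zero_add]
      exact tendsto_avg_phase hl hδ.neg (irrational_neg_div_pi hδ')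
  have hX := ((cross ha hc α hβ hirr).sub
    (cross ha (tendsto_const_nhds (x := c₀)) α (tendsto_const_nhds (x := β₀)) hirr₀)).sub
    ((cross (tendsto_const_nhds (x := a₀)) hc (fun _ => α₀) hβ hirr).sub
    (cross (tendsto_const_nhds (x := a₀)) (tendsto_const_nhds (x := c₀)) (fun _ => α₀)
      (tendsto_const_nhds (x := β₀)) hirr₀))
  simp only [sub_zero] at hX
  obtain ⟨hlin, hquad⟩ := tendsto_avg_sq_of_add (hX.congr fun n => by
    rw [← avg_sub, ← avg_sub, ← avg_sub]
    refine avg_congr fun t => ?_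
    rw [← mul_sub, ← mul_sub, ← sub_mul]) h
  obtain ⟨haa, hαα⟩ := eq_of_tendsto_avg_linear_sq hl ha ha₀ hα hα' hα₀ hlin
  refine ⟨haa, hαα, ?_⟩
  obtain ⟨h0, h1⟩ := hβ'
  obtain ⟨h2, h3⟩ := hβ₀
  by_cases hadd : Irrational ((β' + β₀) / Real.pi)
  · obtain ⟨hcc, hexp⟩ := eq_of_tendsto_avg_quadratic_sq hl hc hc₀ hβ hirr hirr₀ hadd hquad
    refine ⟨hcc, ?_⟩
    by_contra hne
    exact exp_mul_I_ne_one (by linarith) (by linarith) (sub_ne_zero.2 hne) hexp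
  -- Here the sum of the rates may resonate. Conjugating the fitted chirp keeps its real part and
  -- turns the sum into `2 * β₀` minus a rational multiple of `π`; the conclusion would make `β' +
  -- β₀` a multiple of `2π`, but it lies strictly between `0` and `2π`.
  · rw [Irrational, not_not] at hadd
    obtain ⟨q, hq⟩ := hadd
    have hadd' : Irrational ((-β' + β₀) / Real.pi) := by
      have := (irrational_two_mul_div_pi hirr₀).sub_ratCast q
      convert this using 1
      rw [hq]; ring
    have := (eq_of_tendsto_avg_quadratic_sq hl (tendsto_conj hc) hc₀ hβ.neg
      (irrational_neg_div_pi hirr) hirr₀ hadd' (hquad.congr fun n => avg_congr fun t => by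
        have e : (starRingEnd ℂ) (c n) * phase (-β n) 0 t =
            (starRingEnd ℂ) (c n * phase (β n) 0 t) := by
          rw [map_mul, conj_phase, neg_zero]
        rw [e, Complex.conj_re])).2
    exact absurd this (exp_mul_I_ne_one (by linarith) (by linarith) (by linarith))

/-! ### Strong law for orthogonal variables -/

theorem ae_summable_of_summable_integral {Ω ι : Type*} [MeasurableSpace Ω] {μ : Measure Ω}
    [Countable ι] {f : ι → Ω → ℝ} (h0 : ∀ i ω, 0 ≤ f i ω) (hf : ∀ i, Integrable (f i) μ)
    (hs : Summable fun i => ∫ ω, f i ω ∂μ) : ∀ᵐ ω ∂μ, Summable fun i => f i ω := by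
  have h1 : ∀ i, ∫⁻ ω, ENNReal.ofReal (f i ω) ∂μ = ENNReal.ofReal (∫ ω, f i ω ∂μ) := fun i =>
    (ofReal_integral_eq_lintegral_ofReal (hf i) (ae_of_all _ (h0 i))).symm
  have h2 : ∫⁻ ω, ∑' i, ENNReal.ofReal (f i ω) ∂μ ≠ ⊤ := by
    rw [lintegral_tsum fun i => (hf i).aemeasurable.ennreal_ofReal]
    simp only [h1]
    exact hs.tsum_ofReal_ne_top
  have h3 : AEMeasurable (fun ω => ∑' i, ENNReal.ofReal (f i ω)) μ :=
    AEMeasurable.tsum fun i => (hf i).aemeasurable.ennreal_ofReal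
  filter_upwards [ae_lt_top' h3 h2] with ω hω
  simpa [ENNReal.toReal_ofReal (h0 _ _)] using ENNReal.summable_toReal hω.ne

/-- Only the `n` diagonal products survive integration, against the factor `1 / n ^ 2`. -/
theorem integral_sq_avg_le {Ω : Type*} [MeasurableSpace Ω] {μ : Measure Ω} {D : ℕ → Ω → ℝ}
    (hD : ∀ t, MemLp (D t) 2 μ) {V : ℝ} (hV : ∀ t, ∫ ω, D t ω ^ 2 ∂μ ≤ V)
    (horth : ∀ s t, s < t → ∫ ω, D s ω * D t ω ∂μ = 0) (n : ℕ) :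
    ∫ ω, avg (fun t => D t ω) n ^ 2 ∂μ ≤ (n : ℝ)⁻¹ * V := by
  have horth' : ∀ s t, s ≠ t → ∫ ω, D s ω * D t ω ∂μ = 0 := by
    intro s t hst
    rcases lt_or_gt_of_ne hst with h | h
    · exact horth s t h
    · simpa only [mul_comm] using horth t s h
  have hint : ∀ s t, Integrable (fun ω => D s ω * D t ω) μ := fun s t =>
    (hD s).integrable_mul (hD t)
  have h1 : ∀ ω, avg (fun t => D t ω) n ^ 2 =
      ((n : ℝ)⁻¹) ^ 2 * ∑ s ∈ Finset.Icc 1 n, ∑ t ∈ Finset.Icc 1 n, D s ω * D t ω := by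
    intro ω
    rw [avg, smul_eq_mul, mul_pow, sq (∑ t ∈ Finset.Icc 1 n, D t ω), Finset.sum_mul_sum]
  simp only [h1]
  rw [integral_const_mul, integral_finsetSum _ fun s _ => integrable_finsetSum _ fun t _ => hint s t]
  have h2 : ∀ s ∈ Finset.Icc 1 n, ∫ ω, ∑ t ∈ Finset.Icc 1 n, D s ω * D t ω ∂μ ≤ V := by
    intro s hs
    rw [integral_finsetSum _ fun t _ => hint s t,
      Finset.sum_eq_single_of_mem s hs fun t _ hts => horth' s t hts.symm]
    simpa only [sq] using hV s
  refine (mul_le_mul_of_nonneg_left (Finset.sum_le_card_nsmul _ _ V h2) (by positivity)).trans ?_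
  rcases eq_or_ne n 0 with rfl | hn
  · simp
  have : (n : ℝ) ≠ 0 := by exact_mod_cast hn
  simp only [Nat.card_Icc, add_tsub_cancel_right, nsmul_eq_mul]
  apply le_of_eq
  field_simp

theorem memLp_avg {Ω : Type*} [MeasurableSpace Ω] {μ : Measure Ω} {D : ℕ → Ω → ℝ}
    (hD : ∀ t, MemLp (D t) 2 μ) (n : ℕ) : MemLp (fun ω => avg (fun t => D t ω) n) 2 μ := by
  simp only [avg, smul_eq_mul]
  exact (memLp_finsetSum _ fun t _ => hD t).const_mul _

/-- Averages of a bounded sequence converge to zero if they do so along the squares. -/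
theorem tendsto_avg_of_squares {u : ℕ → ℝ} {C : ℝ} (hu : ∀ t, |u t| ≤ C)
    (h : Tendsto (fun k => avg u ((k + 1) ^ 2)) atTop (𝓝 0)) :
    Tendsto (avg u) atTop (𝓝 0) := by
  have hC : 0 ≤ C := (abs_nonneg _).trans (hu 0)
  -- With `k = Nat.sqrt n - 1`, `(k + 1) ^ 2` is the largest square up to `n`, and at most `2 * (k +
  -- 1)` terms follow it.
  have hk : Tendsto (fun n => Nat.sqrt n - 1) atTop atTop :=
    (tendsto_sub_atTop_nat 1).comp <| tendsto_atTop_atTop.2 fun b => ⟨b * b, fun n hn => Nat.le_sqrt.2 hn⟩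
  have h1 := (h.norm.comp hk).add ((tendsto_inv_atTop_nhds_zero_nat (𝕜 := ℝ)).comp
    ((tendsto_add_atTop_nat 1).comp hk) |>.mul_const (2 * C))
  simp only [norm_zero, zero_mul, add_zero] at h1
  refine squeeze_zero_norm' ?_ h1
  filter_upwards [eventually_ge_atTop 1] with n hn
  have hs1 : 1 ≤ Nat.sqrt n := Nat.le_sqrt.2 (by simpa using hn)
  obtain ⟨k, hk⟩ : ∃ k, Nat.sqrt n = k + 1 := ⟨Nat.sqrt n - 1, by omega⟩
  simp only [Function.comp_apply, hk, add_tsub_cancel_right]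
  have hle : (k + 1) ^ 2 ≤ n := by rw [← hk]; exact Nat.sqrt_le' n
  have hup : n ≤ (k + 1) ^ 2 + 2 * (k + 1) := by
    have := Nat.sqrt_le_add n
    rw [hk] at this
    nlinarith
  have hn0 : (0 : ℝ) < n := by exact_mod_cast hn
  have hsum : ∑ t ∈ Finset.Icc 1 n, u t = ∑ t ∈ Finset.Icc 1 ((k + 1) ^ 2), u t +
      ∑ t ∈ Finset.Ioc ((k + 1) ^ 2) n, u t := by
    have e : ∀ m, Finset.Icc 1 m = Finset.Ioc 0 m := fun m => rfl
    rw [e, e, Finset.sum_Ioc_consecutive _ (Nat.zero_le _) hle]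
  have hb : ‖∑ t ∈ Finset.Ioc ((k + 1) ^ 2) n, u t‖ ≤ 2 * (k + 1) * C := by
    refine (norm_sum_le _ _).trans ((Finset.sum_le_card_nsmul _ _ C fun t _ => hu t).trans ?_)
    rw [Nat.card_Ioc, nsmul_eq_mul]
    gcongr
    have : n - (k + 1) ^ 2 ≤ 2 * (k + 1) := by omega
    exact_mod_cast this
  have hle' : ((k : ℝ) + 1) ^ 2 ≤ n := by exact_mod_cast hle
  have hA : ∑ t ∈ Finset.Icc 1 ((k + 1) ^ 2), u t = ((k : ℝ) + 1) ^ 2 * avg u ((k + 1) ^ 2) := by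
    simp only [avg, smul_eq_mul]; push_cast; field_simp
  rw [show avg u n = (n : ℝ)⁻¹ * ∑ t ∈ Finset.Icc 1 n, u t from rfl, norm_mul, norm_inv,
    Real.norm_natCast, hsum, hA, inv_mul_le_iff₀ hn0]
  refine (norm_add_le _ _).trans ?_
  rw [norm_mul, mul_add]
  refine add_le_add ?_ (hb.trans ?_)
  · rw [Real.norm_of_nonneg (by positivity)]
    gcongr
  · push_cast
    calc 2 * ((k : ℝ) + 1) * C = ((k : ℝ) + 1) ^ 2 * (((k : ℝ) + 1)⁻¹ * (2 * C)) := by field_simp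
      _ ≤ _ := by gcongr

/-- Strong law of large numbers for bounded orthogonal random variables. -/
theorem ae_tendsto_avg_of_orthogonal {Ω : Type*} [MeasurableSpace Ω] {μ : Measure Ω}
    [IsProbabilityMeasure μ] {D : ℕ → Ω → ℝ} (hm : ∀ t, Measurable (D t)) {C : ℝ}
    (hC : ∀ t ω, |D t ω| ≤ C) (horth : ∀ s t, s < t → ∫ ω, D s ω * D t ω ∂μ = 0) :
    ∀ᵐ ω ∂μ, Tendsto (avg fun t => D t ω) atTop (𝓝 0) := by
  have hD : ∀ t, MemLp (D t) 2 μ := fun t =>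
    MemLp.of_bound (hm t).aestronglyMeasurable C (ae_of_all _ (hC t))
  have hV : ∀ t, ∫ ω, D t ω ^ 2 ∂μ ≤ C ^ 2 := by
    intro t
    refine (integral_mono (hD t).integrable_sq (integrable_const (C ^ 2)) fun ω => ?_).trans
      (by simp)
    exact sq_le_sq' (abs_le.1 (hC t ω)).1 (abs_le.1 (hC t ω)).2
  -- Along squares the second moments are at most `C ^ 2 / (k + 1) ^ 2`, which is summable.
  have h1 := ae_summable_of_summable_integral (μ := μ)
    (f := fun (k : ℕ) ω => avg (fun t => D t ω) ((k + 1) ^ 2) ^ 2) (fun _ _ => sq_nonneg _)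
    (fun k => (memLp_avg hD _).integrable_sq) (by
      refine Summable.of_nonneg_of_le (fun k => integral_nonneg fun ω => sq_nonneg _)
        (fun k => integral_sq_avg_le hD hV horth ((k + 1) ^ 2)) ?_
      have := (summable_nat_add_iff 1).2 (Real.summable_nat_pow_inv.2 one_lt_two)
      refine (this.mul_right (C ^ 2)).congr fun k => ?_
      push_cast; rfl)
  filter_upwards [h1] with ω hω
  exact tendsto_avg_of_squares (fun t => hC t ω) (tendsto_zero_of_sq hω.tendsto_atTop_zero)

/-- A centred variable is orthogonal to products of other members of an independent family. -/
theorem integral_mul_prod_eq_zero {Ω ι κ : Type*} [MeasurableSpace Ω] {μ : Measure Ω}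
    [DecidableEq ι] [Fintype κ] {b : ι → Ω → ℝ} (hind : iIndepFun b μ)
    (hm : ∀ i, Measurable (b i)) {T : ι} (hT : ∫ ω, b T ω ∂μ = 0) (i : κ → ι)
    (hi : ∀ k, i k ≠ T) : ∫ ω, b T ω * ∏ k, b (i k) ω ∂μ = 0 := by
  set S : Finset ι := Finset.univ.image i
  have hS : ∀ k, i k ∈ S := fun k => Finset.mem_image_of_mem _ (Finset.mem_univ k)
  have hdis : Disjoint ({T} : Finset ι) S := by
    rw [Finset.disjoint_singleton_left, Finset.mem_image]
    rintro ⟨k, -, hk⟩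
    exact hi k hk
  have hφ : Measurable fun v : ({T} : Finset ι) → ℝ => v ⟨T, Finset.mem_singleton_self T⟩ :=
    measurable_pi_apply _
  have hψ : Measurable fun v : S → ℝ => ∏ k, v ⟨i k, hS k⟩ :=
    Finset.measurable_fun_prod _ fun k _ => measurable_pi_apply _
  have h := (hind.indepFun_finset {T} S hdis hm).comp hφ hψ
  have h2 := h.integral_fun_mul_eq_mul_integral
    (by exact (hm T).aestronglyMeasurable)
    (by exact (Finset.measurable_fun_prod _ fun k _ => hm (i k)).aestronglyMeasurable)
  simp only [Function.comp_apply, hT, zero_mul] at h2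
  exact h2

/-- For `s < t` the index `t + T` exceeds the seven others in the product of the terms at `s` and
`t`, so its centred factor kills the expectation even if other indices coincide. -/
theorem ae_tendsto_avg_quadruple {Ω : Type*} [MeasurableSpace Ω] {μ : Measure Ω}
    [IsProbabilityMeasure μ] {b : ℤ → Ω → ℝ} (hind : iIndepFun b μ) (hm : ∀ i, Measurable (b i))
    {C : ℝ} (hC : ∀ i ω, |b i ω| ≤ C) (hmean : ∀ i, ∫ ω, b i ω ∂μ = 0) {T i₁ i₂ i₃ : ℤ}
    (h₁ : i₁ < T) (h₂ : i₂ < T) (h₃ : i₃ < T) :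
    ∀ᵐ ω ∂μ, Tendsto (avg fun t => b (t + T) ω * (b (t + i₁) ω * b (t + i₂) ω * b (t + i₃) ω))
      atTop (𝓝 0) := by
  refine ae_tendsto_avg_of_orthogonal (C := C * (C * C * C)) (fun t => ?_) (fun t ω => ?_) ?_
  · exact (hm _).mul (((hm _).mul (hm _)).mul (hm _))
  · have := hC 0 ω
    have hC0 := (abs_nonneg _).trans this
    simp only [abs_mul]
    gcongr <;> exact hC _ _
  · intro s t hst
    have := integral_mul_prod_eq_zero hind hm (hmean (t + T))
      (![t + i₁, t + i₂, t + i₃, s + T, s + i₁, s + i₂, s + i₃] : Fin 7 → ℤ) (by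
        intro k; fin_cases k <;> simp <;> omega)
    rw [← this]
    refine integral_congr_ae (ae_of_all _ fun ω => ?_)
    simp [Fin.prod_univ_succ]
    ring

/-! ### Uniform law for bounded independent noise -/

/-- Pathwise form of the uniform law: averages against quadratic phases vanish if the second-order
correlations do. -/
theorem tendsto_avg_mul_phase_of_correlation {l : Filter ℕ} (hl : l ≤ atTop) {x : ℕ → ℝ} {C : ℝ}
    (hx : ∀ t, |x t| ≤ C)
    (hcor : ∀ h h' k k' : ℕ, h ≠ h' → k ≠ k' → Tendsto (avg fun t =>
      x (t + k + h) * x (t + k + h') * (x (t + k' + h) * x (t + k' + h'))) l (𝓝 0))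
    (β γ : ℕ → ℝ) :
    Tendsto (fun n => avg (fun t => (x t : ℂ) * phase (β n) (γ n) t) n) l (𝓝 0) := by
  have hC : 0 ≤ C := (abs_nonneg _).trans (hx 0)
  refine tendsto_avg_of_correlation hl (C := C) (fun n t => by simpa using hx t) ?_
  intro h h' hne
  -- The first differencing leaves a linear phase, whose frequency still depends on `n`; the second
  -- reduces it to a unimodular constant.
  have key : Tendsto (fun n => avg (fun t => ((x (t + h) * x (t + h') : ℝ) : ℂ) *
      phase 0 (2 * β n * (h - h')) t) n) l (𝓝 0) := by
    refine tendsto_avg_of_correlation hl (C := C * C) (fun n t => ?_) ?_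
    · rw [norm_mul, norm_phase, mul_one, Complex.norm_real, norm_mul]
      exact mul_le_mul (hx _) (hx _) (norm_nonneg _) hC
    intro k k' hk
    refine squeeze_zero_norm (fun n => le_of_eq ?_) (by simpa using (hcor h h' k k' hne hk).norm)
    rw [← Real.norm_eq_abs, ← Complex.norm_real, ← Complex.ofRealCLM_apply, map_avg]
    have e : ∀ t, ((x (t + k + h) * x (t + k + h') : ℝ) : ℂ) * phase 0 (2 * β n * (h - h')) (t + k) *
        (starRingEnd ℂ) (((x (t + k' + h) * x (t + k' + h') : ℝ) : ℂ) *
          phase 0 (2 * β n * (h - h')) (t + k')) =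
        Complex.exp ((((2 * β n * (h - h')) * ((k : ℝ) - k') : ℝ) : ℂ) * Complex.I) *
        ((x (t + k + h) * x (t + k + h') * (x (t + k' + h) * x (t + k' + h')) : ℝ) : ℂ) := by
      intro t
      have := phase_add_mul_conj 0 (2 * β n * (h - h')) k k' t
      simp only [zero_mul, zero_add, mul_zero, phase_zero_zero, mul_one] at this
      rw [← this, map_mul, Complex.conj_ofReal]
      push_cast; ring
    rw [avg_congr e, avg_const_mul, norm_mul, Complex.norm_exp_ofReal_mul_I, one_mul]
    rfl
  refine squeeze_zero_norm (fun n => le_of_eq ?_) (by simpa only [norm_zero] using key.norm)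
  have e : ∀ t, (x (t + h) : ℂ) * phase (β n) (γ n) (t + h) *
      (starRingEnd ℂ) ((x (t + h') : ℂ) * phase (β n) (γ n) (t + h')) =
      Complex.exp (((β n * ((h : ℝ) ^ 2 - (h' : ℝ) ^ 2) + γ n * (h - h') : ℝ) : ℂ) * Complex.I) *
      (((x (t + h) * x (t + h') : ℝ) : ℂ) * phase 0 (2 * β n * (h - h')) t) := by
    intro t
    rw [map_mul, Complex.conj_ofReal]
    have := phase_add_mul_conj (β n) (γ n) h h' t
    rw [mul_left_comm (Complex.exp _), ← this]
    push_cast; ring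
  rw [avg_congr e, avg_const_mul, norm_mul, Complex.norm_exp_ofReal_mul_I, one_mul]

/-- Uniform strong law for bounded independent centred variables against quadratic phases. -/
theorem ae_tendsto_avg_mul_phase_of_bounded {Ω : Type*} [MeasurableSpace Ω] {μ : Measure Ω}
    [IsProbabilityMeasure μ] {b : ℤ → Ω → ℝ} (hind : iIndepFun b μ) (hm : ∀ i, Measurable (b i))
    {C : ℝ} (hC : ∀ i ω, |b i ω| ≤ C) (hmean : ∀ i, ∫ ω, b i ω ∂μ = 0) (j : ℤ) :
    ∀ᵐ ω ∂μ, ∀ β γ : ℕ → ℝ,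
      Tendsto (fun n => avg (fun t => (b (t - j) ω : ℂ) * phase (β n) (γ n) t) n) atTop (𝓝 0) := by
  have hcor : ∀ h h' k k' : ℕ, h ≠ h' → k ≠ k' → ∀ᵐ ω ∂μ, Tendsto (avg fun t : ℕ =>
      b ((t + k + h : ℕ) - j) ω * b ((t + k + h' : ℕ) - j) ω *
        (b ((t + k' + h : ℕ) - j) ω * b ((t + k' + h' : ℕ) - j) ω)) atTop (𝓝 0) := by
    -- In this order `k + h` is strictly the largest shift; the other three orders only permute the
    -- factors.
    have core : ∀ h h' k k' : ℕ, h' < h → k' < k → ∀ᵐ ω ∂μ, Tendsto (avg fun t : ℕ =>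
        b ((t + k + h : ℕ) - j) ω * (b ((t + k + h' : ℕ) - j) ω *
        b ((t + k' + h : ℕ) - j) ω * b ((t + k' + h' : ℕ) - j) ω)) atTop (𝓝 0) := by
      intro h h' k k' hh hk
      have := ae_tendsto_avg_quadruple hind hm hC hmean (T := k + h - j) (i₁ := k + h' - j)
        (i₂ := k' + h - j) (i₃ := k' + h' - j) (by omega) (by omega) (by omega)
      simpa only [Nat.cast_add, add_sub_assoc, add_assoc] using this
    intro h h' k k' hh hk
    rcases lt_or_gt_of_ne hh with h1 | h1 <;> rcases lt_or_gt_of_ne hk with h2 | h2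
    · filter_upwards [core h' h k' k h1 h2] with ω hω
      refine hω.congr fun n => avg_congr fun t => by ring
    · filter_upwards [core h' h k k' h1 h2] with ω hω
      refine hω.congr fun n => avg_congr fun t => by ring
    · filter_upwards [core h h' k' k h1 h2] with ω hω
      refine hω.congr fun n => avg_congr fun t => by ring
    · filter_upwards [core h h' k k' h1 h2] with ω hω
      refine hω.congr fun n => avg_congr fun t => by ring
  -- Only countably many shifts occur, so a single null set serves all `β` and `γ`.
  have hall : ∀ᵐ ω ∂μ, ∀ h h' k k' : ℕ, h ≠ h' → k ≠ k' → Tendsto (avg fun t : ℕ =>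
      b ((t + k + h : ℕ) - j) ω * b ((t + k + h' : ℕ) - j) ω *
        (b ((t + k' + h : ℕ) - j) ω * b ((t + k' + h' : ℕ) - j) ω)) atTop (𝓝 0) := by
    simp only [ae_all_iff]
    exact hcor
  filter_upwards [hall] with ω hω β γ
  exact tendsto_avg_mul_phase_of_correlation le_rfl (x := fun t : ℕ => b (t - j) ω)
    (fun t => hC _ ω) (fun h h' k k' hh hk => hω h h' k k' hh hk) β γ

/-! ### Truncation: integrable independent noise -/

/-- The truncation of `x` to the interval `[-K, K]`. -/
def clamp (K x : ℝ) : ℝ := max (-K) (min x K)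

theorem measurable_clamp (K : ℝ) : Measurable (clamp K) := by
  unfold clamp; fun_prop

theorem abs_clamp_le {K : ℝ} (hK : 0 ≤ K) (x : ℝ) : |clamp K x| ≤ K := by
  unfold clamp
  rw [abs_le]
  exact ⟨le_max_left _ _, max_le (by linarith) (min_le_right _ _)⟩

theorem abs_sub_clamp_le {K : ℝ} (hK : 0 ≤ K) (x : ℝ) : |x - clamp K x| ≤ |x| := by
  unfold clamp
  rcases le_total x K with h1 | h1
  · rw [min_eq_left h1]
    rcases le_total (-K) x with h2 | h2
    · rw [max_eq_right h2]; simp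
    · rw [max_eq_left h2, abs_of_nonpos (by linarith), abs_of_nonpos (by linarith)]; linarith
  · rw [min_eq_right h1, max_eq_right (by linarith), abs_of_nonneg (by linarith),
      abs_of_nonneg (by linarith)]
    linarith

theorem clamp_of_abs_le {K x : ℝ} (h : |x| ≤ K) : clamp K x = x := by
  rw [abs_le] at h
  rw [clamp, min_eq_left h.2, max_eq_right h.1]

variable {Ω : Type*} [MeasurableSpace Ω] {μ : Measure Ω}

theorem tendsto_integral_abs_sub_clamp {f : Ω → ℝ} (hf : Integrable f μ) :
    Tendsto (fun K : ℕ => ∫ ω, |f ω - clamp K (f ω)| ∂μ) atTop (𝓝 0) := by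
  have := tendsto_integral_of_dominated_convergence (μ := μ)
    (F := fun (K : ℕ) ω => |f ω - clamp K (f ω)|) (f := fun _ => 0) (fun ω => |f ω|)
    (fun K => by
      have := (measurable_clamp K).comp_aemeasurable hf.aemeasurable
      exact (hf.aemeasurable.sub this).norm.aestronglyMeasurable) hf.abs
    (fun K => ae_of_all _ fun ω => by
      rw [Real.norm_eq_abs, abs_abs]; exact abs_sub_clamp_le K.cast_nonneg _)
    (ae_of_all _ fun ω => tendsto_const_nhds.congr' (by
      filter_upwards [eventually_ge_atTop ⌈|f ω|⌉₊] with K hK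
      rw [clamp_of_abs_le ((Nat.le_ceil _).trans (by exact_mod_cast hK))]; simp))
  simpa using this

theorem ae_tendsto_avg_comp {e : ℤ → Ω → ℝ} (hind : iIndepFun e μ)
    (hid : ∀ s t, IdentDistrib (e s) (e t) μ μ) {g : ℝ → ℝ} (hg : Measurable g)
    (hint : Integrable (fun ω => g (e 0 ω)) μ) (j : ℤ) :
    ∀ᵐ ω ∂μ, Tendsto (avg fun t : ℕ => g (e (t - j) ω)) atTop (𝓝 (∫ ω, g (e 0 ω) ∂μ)) := by
  have hid' : ∀ s t, IdentDistrib (fun ω => g (e s ω)) (fun ω => g (e t ω)) μ μ := fun s t =>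
    (hid s t).comp hg
  -- The shift by one matches sums over `range n` with averages over `1, …, n`.
  have := strong_law_ae_real (μ := μ) (fun (i : ℕ) ω => g (e ((i + 1 : ℕ) - j) ω))
    ((hid' _ _).integrable_iff.2 hint) (fun s t hst => by
      have := hind.indepFun (i := ((s + 1 : ℕ) - j : ℤ)) (j := ((t + 1 : ℕ) - j : ℤ)) (by
        push_cast; omega)
      exact this.comp hg hg) (fun i => hid' _ _)
  filter_upwards [this] with ω hω
  rw [(hid' _ 0).integral_eq] at hω
  refine hω.congr fun n => ?_
  rw [avg, smul_eq_mul, div_eq_inv_mul, Finset.range_eq_Ico,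
    Finset.sum_Ico_add' (fun t : ℕ => g (e (t - j) ω)) 0 n 1]
  rfl

variable [IsProbabilityMeasure μ]

/-- Uniform strong law for independent identically distributed centred variables against
quadratic phases. -/
theorem ae_tendsto_avg_mul_phase {e : ℤ → Ω → ℝ} (hind : iIndepFun e μ)
    (hm : ∀ i, Measurable (e i)) (hid : ∀ s t, IdentDistrib (e s) (e t) μ μ)
    (hint : Integrable (e 0) μ) (hmean : ∫ ω, e 0 ω ∂μ = 0) (j : ℤ) :
    ∀ᵐ ω ∂μ, ∀ β γ : ℕ → ℝ,
      Tendsto (fun n => avg (fun t => (e (t - j) ω : ℂ) * phase (β n) (γ n) t) n) atTop (𝓝 0) := by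
  set m : ℕ → ℝ := fun K => ∫ ω, clamp K (e 0 ω) ∂μ
  set δ : ℕ → ℝ := fun K => ∫ ω, |e 0 ω - clamp K (e 0 ω)| ∂μ
  have hδ : Tendsto δ atTop (𝓝 0) := tendsto_integral_abs_sub_clamp hint
  have hcl : ∀ (K : ℕ) i, Integrable (fun ω => clamp K (e i ω)) μ := fun K i =>
    Integrable.of_bound ((measurable_clamp K).comp (hm i)).aestronglyMeasurable K
      (ae_of_all _ fun ω => abs_clamp_le K.cast_nonneg _)
  have hm_le : ∀ K, |m K| ≤ δ K := by
    intro K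
    have : m K = -∫ ω, (e 0 ω - clamp K (e 0 ω)) ∂μ := by
      rw [integral_sub hint (hcl K 0), hmean]; simp [m]
    rw [this, abs_neg]
    exact norm_integral_le_integral_norm fun ω => e 0 ω - clamp K (e 0 ω)
  have h1 : ∀ᵐ ω ∂μ, ∀ (K : ℕ) (β γ : ℕ → ℝ), Tendsto (fun n =>
      avg (fun t => ((clamp K (e (t - j) ω) - m K : ℝ) : ℂ) * phase (β n) (γ n) t) n)
      atTop (𝓝 0) := by
    rw [ae_all_iff]
    intro K
    have hg : Measurable fun x => clamp K x - m K := (measurable_clamp K).sub_const _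
    refine ae_tendsto_avg_mul_phase_of_bounded (b := fun i ω => clamp K (e i ω) - m K)
      (hind.comp (fun _ x => clamp K x - m K) fun _ => hg) (fun i => hg.comp (hm i))
      (C := K + |m K|) (fun i ω => ?_) (fun i => ?_) j
    · exact (abs_sub _ _).trans (by gcongr; exact abs_clamp_le K.cast_nonneg _)
    · rw [integral_sub (hcl K i) (integrable_const _)]
      have := ((hid i 0).comp (measurable_clamp K)).integral_eq
      simp only [Function.comp_apply] at this
      simp [this, m]
  have h2 : ∀ᵐ ω ∂μ, ∀ K : ℕ, Tendsto (avg fun t : ℕ => |e (t - j) ω - clamp K (e (t - j) ω)|)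
      atTop (𝓝 (δ K)) := by
    rw [ae_all_iff]
    intro K
    exact ae_tendsto_avg_comp hind hid (g := fun x => |x - clamp K x|)
      ((measurable_id.sub (measurable_clamp K)).norm) (hint.sub (hcl K 0)).abs j
  filter_upwards [h1, h2] with ω h1 h2 β γ
  rw [Metric.tendsto_nhds]
  intro ε hε
  obtain ⟨K, hK⟩ := (hδ.eventually_lt_const (show 0 < ε / 2 by positivity)).exists
  have hlim := ((h1 K β γ).norm.add (h2 K)).add_const (δ K)
  rw [norm_zero, zero_add] at hlim
  filter_upwards [hlim.eventually_lt_const (show δ K + δ K < ε by linarith)] with n hn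
  rw [dist_zero_right]
  refine lt_of_le_of_lt ?_ hn
  -- Centred truncation, tail and truncated mean: the first averages to zero, and the others
  -- contribute at most `δ K` each in the limit.
  have e1 : ∀ t : ℕ, (e (t - j) ω : ℂ) * phase (β n) (γ n) t =
      ((clamp K (e (t - j) ω) - m K : ℝ) : ℂ) * phase (β n) (γ n) t +
      (((e (t - j) ω - clamp K (e (t - j) ω) : ℝ) : ℂ) * phase (β n) (γ n) t +
        (m K : ℂ) * phase (β n) (γ n) t) := by
    intro t; push_cast; ring
  rw [avg_congr e1, avg_add, avg_add, add_assoc]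
  refine (norm_add_le _ _).trans (add_le_add le_rfl ((norm_add_le _ _).trans (add_le_add ?_ ?_)))
  · refine (norm_avg_le _ n).trans (le_of_eq (avg_congr fun t => ?_))
    rw [norm_mul, norm_phase, mul_one, Complex.norm_real, Real.norm_eq_abs]
  · refine (norm_avg_le _ n).trans (avg_le_const ((abs_nonneg _).trans (hm_le K)) fun t => ?_)
    rw [norm_mul, norm_phase, mul_one, Complex.norm_real]
    exact hm_le K

/-! ### Linear processes -/

theorem avg_le_two_mul_avg_pow_clog {u : ℕ → ℝ} (hu : ∀ t, 0 ≤ u t) {n : ℕ} (hn : n ≠ 0) :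
    avg u n ≤ 2 * avg u (2 ^ Nat.clog 2 n) := by
  have hle := Nat.le_pow_clog one_lt_two n
  -- Rounding up to a power of two at most doubles `n`, so dyadic averages control all averages.
  have hlt : 2 ^ Nat.clog 2 n ≤ 2 * n := by
    rcases eq_or_ne n 1 with rfl | h1
    · simp
    · have h2 := Nat.pow_pred_clog_lt_self one_lt_two (x := n) (by omega)
      have h3 : 0 < Nat.clog 2 n := Nat.clog_pos one_lt_two (by omega)
      obtain ⟨m, hm⟩ : ∃ m, Nat.clog 2 n = m + 1 := ⟨Nat.clog 2 n - 1, by omega⟩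
      rw [hm, Nat.pred_succ] at h2
      rw [hm, pow_succ]; omega
  have hn0 : (0 : ℝ) < n := by exact_mod_cast Nat.pos_of_ne_zero hn
  have hlt' : ((2 ^ Nat.clog 2 n : ℕ) : ℝ) ≤ 2 * n := by exact_mod_cast hlt
  have hN0 : (0 : ℝ) < (2 ^ Nat.clog 2 n : ℕ) := by positivity
  simp only [avg, smul_eq_mul]
  rw [← mul_assoc]
  refine mul_le_mul ?_ ?_ (Finset.sum_nonneg fun t _ => hu t) (by positivity)
  · rw [inv_le_iff_one_le_mul₀ hn0, mul_right_comm, mul_comm (2 * (n : ℝ)),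
      ← div_eq_inv_mul, one_le_div hN0]
    exact hlt'
  · exact Finset.sum_le_sum_of_subset_of_nonneg (Finset.Icc_subset_Icc_right hle)
      fun t _ _ => hu t

/-- The averages of `|e (t - j)|` have a maximal function that is almost surely summable against
a summable weight. -/
theorem ae_exists_summable_bound {e : ℤ → Ω → ℝ} (hind : iIndepFun e μ)
    (hid : ∀ s t, IdentDistrib (e s) (e t) μ μ) (hL : ∀ t, MemLp (e t) 2 μ) {a : ℤ → ℝ}
    (ha : Summable fun j => |a j|) :
    ∀ᵐ ω ∂μ, ∃ B : ℤ → ℝ, Summable B ∧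
      ∀ n ≠ 0, ∀ j, |a j| * avg (fun t : ℕ => |e (t - j) ω|) n ≤ B j := by
  set m : ℝ := ∫ ω, |e 0 ω| ∂μ
  have hm0 : 0 ≤ m := integral_nonneg fun ω => abs_nonneg _
  set b : ℤ → Ω → ℝ := fun i ω => |e i ω| - m
  set V : ℝ := ∫ ω, b 0 ω ^ 2 ∂μ
  have hg : Measurable fun x : ℝ => |x| - m := by fun_prop
  have hbind : iIndepFun b μ := hind.comp (fun _ x => |x| - m) fun _ => hg
  have hbid : ∀ s t, IdentDistrib (b s) (b t) μ μ := fun s t => (hid s t).comp hg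
  have hbL : ∀ t, MemLp (b t) 2 μ := fun t => (hL t).abs.sub (memLp_const m)
  have hbmean : ∀ t, ∫ ω, b t ω ∂μ = 0 := by
    intro t
    rw [(hbid t 0).integral_eq]
    change ∫ ω, (|e 0 ω| - m) ∂μ = 0
    rw [integral_sub ((hL 0).integrable one_le_two).abs (integrable_const _)]
    simp [m]
  have hbV : ∀ t, ∫ ω, b t ω ^ 2 ∂μ ≤ V := fun t =>
    ((hbid t 0).comp (measurable_id.pow_const 2)).integral_eq.le
  have hD : ∀ (j : ℤ) (n : ℕ), ∫ ω, avg (fun t : ℕ => b (t - j) ω) n ^ 2 ∂μ ≤ (n : ℝ)⁻¹ * V :=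
    fun j n => integral_sq_avg_le (D := fun t : ℕ => b (t - j)) (fun t => hbL _) (fun t => hbV _)
      (fun s t hst => by
        have := (hbind.indepFun (i := (s - j : ℤ)) (j := (t - j : ℤ)) (by omega))
        have := this.integral_fun_mul_eq_mul_integral (hbL _).aestronglyMeasurable
          (hbL _).aestronglyMeasurable
        rw [this, hbmean, zero_mul]) n
  have hDL : ∀ (j : ℤ) (n : ℕ), MemLp (fun ω => avg (fun t : ℕ => b (t - j) ω) n) 2 μ :=
    fun j n => memLp_avg (D := fun t : ℕ => b (t - j)) (fun t => hbL _) n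
  -- The term at `(j, k)` has expectation at most `|a j| * 2 ^ (-k) * V`, summable over both
  -- indices; this is where finite variance enters.
  have hsum := ae_summable_of_summable_integral (μ := μ) (ι := ℤ × ℕ)
    (f := fun p ω => |a p.1| * avg (fun t : ℕ => b (t - p.1) ω) (2 ^ p.2) ^ 2)
    (fun p ω => by positivity) (fun p => (hDL _ _).integrable_sq.const_mul _) (by
      have h1 : Summable fun p : ℤ × ℕ => |a p.1| * ((1 / 2 : ℝ) ^ p.2) :=
        ha.mul_of_nonneg summable_geometric_two (fun _ => abs_nonneg _) fun _ => by positivity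
      refine Summable.of_nonneg_of_le (fun p => integral_nonneg fun ω => by positivity)
        (fun p => ?_) (h1.mul_right V)
      rw [integral_const_mul, mul_assoc]
      refine mul_le_mul_of_nonneg_left ((hD p.1 (2 ^ p.2)).trans_eq ?_) (abs_nonneg _)
      simp)
  filter_upwards [hsum] with ω hω
  refine ⟨fun j => 2 * (m + 1) * |a j| +
    2 * ∑' k : ℕ, |a j| * avg (fun t : ℕ => b (t - j) ω) (2 ^ k) ^ 2, ?_, ?_⟩
  · exact (ha.mul_left _).add ((hω.prod).mul_left 2)
  · intro n hn j
    set x := avg (fun t : ℕ => b (t - j) ω) (2 ^ Nat.clog 2 n) with hx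
    have h1 := avg_le_two_mul_avg_pow_clog (u := fun t : ℕ => |e (t - j) ω|)
      (fun t => abs_nonneg _) hn
    have h2 : avg (fun t : ℕ => |e (t - j) ω|) (2 ^ Nat.clog 2 n) = m + x := by
      rw [hx, avg_sub, avg_const (by positivity)]; ring
    -- Passing to squares replaces the supremum over dyadic scales by a convergent sum.
    have h3 : x ≤ 1 + x ^ 2 := by nlinarith [sq_nonneg (x - 1)]
    have h4 : |a j| * x ^ 2 ≤ ∑' k : ℕ, |a j| * avg (fun t : ℕ => b (t - j) ω) (2 ^ k) ^ 2 :=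
      (hω.prod_factor j).le_tsum (Nat.clog 2 n) fun k _ => by positivity
    calc |a j| * avg (fun t : ℕ => |e (t - j) ω|) n ≤ |a j| * (2 * (m + (1 + x ^ 2))) := by
          refine mul_le_mul_of_nonneg_left ?_ (abs_nonneg _)
          linarith
      _ = 2 * (m + 1) * |a j| + 2 * (|a j| * x ^ 2) := by ring
      _ ≤ _ := add_le_add le_rfl (mul_le_mul_of_nonneg_left h4 two_pos.le)

/-- Uniform strong law for linear processes against quadratic phases. -/
theorem IsLinearProcess.ae_tendsto_avg_mul_phase {a : ℤ → ℝ} {σ : ℝ} {e X : ℤ → Ω → ℝ}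
    (hX : IsLinearProcess μ a σ e X) :
    ∀ᵐ ω ∂μ, ∀ β γ : ℕ → ℝ,
      Tendsto (fun n => avg (fun t : ℕ => (X t ω : ℂ) * phase (β n) (γ n) t) n) atTop (𝓝 0) := by
  have h1 := ae_all_iff.2 fun j => ChirpLike.ae_tendsto_avg_mul_phase hX.indep hX.measurable
    hX.identDistrib ((hX.memLp_two 0).integrable one_le_two) (hX.mean_zero 0) j
  filter_upwards [h1, ae_exists_summable_bound hX.indep hX.identDistrib hX.memLp_two
    hX.summable_abs, ae_all_iff.2 hX.hasSum] with ω h1 hB hXω β γ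
  obtain ⟨B, hBs, hB⟩ := hB
  have hsum : ∀ n, HasSum (fun j => (a j : ℂ) *
      avg (fun t : ℕ => (e (t - j) ω : ℂ) * phase (β n) (γ n) t) n)
      (avg (fun t : ℕ => (X t ω : ℂ) * phase (β n) (γ n) t) n) := by
    intro n
    simp only [avg]
    have h2 : HasSum (fun j => ∑ t ∈ Finset.Icc 1 n,
        ((a j * e (t - j) ω : ℝ) : ℂ) * phase (β n) (γ n) t)
        (∑ t ∈ Finset.Icc 1 n, (X t ω : ℂ) * phase (β n) (γ n) t) :=
      hasSum_sum fun t _ => (Complex.hasSum_ofReal.2 (hXω t)).mul_right _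
    refine (h2.const_smul ((n : ℝ)⁻¹)).congr_fun fun j => ?_
    rw [mul_smul_comm, Finset.mul_sum]
    congr 1
    refine Finset.sum_congr rfl fun t _ => ?_
    push_cast; ring
  -- The convergence for each lag is not uniform in `j`; the bound `B` permits exchanging the limit
  -- with the sum over `j`.
  have hlim := tendsto_tsum_of_dominated_convergence (𝓕 := atTop)
    (f := fun (n : ℕ) (j : ℤ) => (a j : ℂ) *
      avg (fun t : ℕ => (e (t - j) ω : ℂ) * phase (β n) (γ n) t) n) (g := fun _ => 0) hBs
    (fun j => by simpa using (h1 j β γ).const_mul (a j : ℂ)) (by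
      filter_upwards [eventually_ne_atTop 0] with n hn j
      refine le_trans ?_ (hB n hn j)
      rw [norm_mul, Complex.norm_real, Real.norm_eq_abs]
      refine mul_le_mul_of_nonneg_left ((norm_avg_le _ n).trans_eq (avg_congr fun t => ?_))
        (abs_nonneg _)
      rw [norm_mul, norm_phase, mul_one, Complex.norm_real, Real.norm_eq_abs])
  rw [tsum_zero] at hlim
  exact hlim.congr fun n => (hsum n).tsum_eq

/-! ### Consistency of least squares -/

theorem re_mk_mul_phase (A B β γ : ℝ) (t : ℕ) :
    ((⟨A, -B⟩ : ℂ) * phase β γ t).re =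
      A * Real.cos (β * (t : ℝ) ^ 2 + γ * t) + B * Real.sin (β * (t : ℝ) ^ 2 + γ * t) := by
  rw [Complex.mul_re, phase, Complex.exp_ofReal_mul_I_re, Complex.exp_ofReal_mul_I_im]
  ring

theorem signal_eq_re (A B α C D β : ℝ) (t : ℕ) :
    signal (A, B, α, C, D, β) t =
      ((⟨A, -B⟩ : ℂ) * phase 0 α t).re + ((⟨C, -D⟩ : ℂ) * phase β 0 t).re := by
  rw [re_mk_mul_phase, re_mk_mul_phase, signal]
  simp only [zero_mul, zero_add, add_zero]
  ring

theorem tendsto_mk {l : Filter ℕ} {A B : ℕ → ℝ} {A' B' : ℝ} (hA : Tendsto A l (𝓝 A'))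
    (hB : Tendsto B l (𝓝 B')) :
    Tendsto (fun n => (⟨A n, -B n⟩ : ℂ)) l (𝓝 ⟨A', -B'⟩) := by
  simp only [Complex.mk_eq_add_mul_I]
  exact ((Complex.continuous_ofReal.tendsto _).comp hA).add
    (((Complex.continuous_ofReal.tendsto _).comp hB.neg).mul_const _)

theorem mk_ne_zero {A B : ℝ} (h : 0 < A ^ 2 + B ^ 2) : (⟨A, -B⟩ : ℂ) ≠ 0 := by
  intro h0
  have h1 := congrArg Complex.re h0
  have h2 := congrArg Complex.im h0
  simp only [Complex.zero_re, Complex.zero_im, neg_eq_zero] at h1 h2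
  rw [h1, h2] at h
  norm_num at h

theorem isCompact_paramSpace (M : ℝ) : IsCompact (paramSpace M) :=
  isCompact_Icc.prod <| isCompact_Icc.prod <| isCompact_Icc.prod <|
    isCompact_Icc.prod <| isCompact_Icc.prod isCompact_Icc

theorem tendsto_avg_noise_mul_re {l : Filter ℕ} {x : ℕ → ℝ} {a : ℕ → ℂ} {a' : ℂ}
    (ha : Tendsto a l (𝓝 a')) {β γ : ℕ → ℝ}
    (hx : Tendsto (fun n => avg (fun t => (x t : ℂ) * phase (β n) (γ n) t) n) l (𝓝 0)) :
    Tendsto (fun n => avg (fun t => x t * (a n * phase (β n) (γ n) t).re) n) l (𝓝 0) := by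
  have h := (Complex.continuous_re.tendsto _).comp (tendsto_avg_const_mul ha hx)
  simp only [mul_zero, Complex.zero_re] at h
  refine h.congr fun n => ?_
  rw [Function.comp_apply, ← avg_re]
  refine avg_congr fun t => ?_
  rw [mul_left_comm, Complex.re_ofReal_mul]

/-- The basic inequality of least squares: expanding both sides, the `x t ^ 2` terms cancel. -/
theorem avg_sq_sub_le_of_errorSS_le {x f g : ℕ → ℝ} {n : ℕ}
    (h : ∑ t ∈ Finset.Icc 1 n, (f t + x t - g t) ^ 2 ≤
      ∑ t ∈ Finset.Icc 1 n, (f t + x t - f t) ^ 2) :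
    avg (fun t => (g t - f t) ^ 2) n ≤ 2 * (avg (fun t => x t * g t) n - avg (fun t => x t * f t) n) := by
  rw [← avg_sub, ← avg_const_mul]
  simp only [avg, smul_eq_mul]
  refine mul_le_mul_of_nonneg_left ?_ (by positivity)
  rw [← sub_nonneg, ← Finset.sum_sub_distrib] at h ⊢
  refine h.trans_eq (Finset.sum_congr rfl fun t _ => ?_)
  ring

/-- Pathwise consistency: if the noise averages out uniformly against quadratic phases, least
squares estimates converge to the true parameter. -/
theorem tendsto_of_isLSE {M A₀ B₀ α₀ C₀ D₀ β₀ : ℝ}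
    (hint : (A₀, B₀, α₀, C₀, D₀, β₀) ∈ interior (paramSpace M))
    (hAB : 0 < A₀ ^ 2 + B₀ ^ 2) (hCD : 0 < C₀ ^ 2 + D₀ ^ 2)
    (hβ₀ : Irrational (β₀ / Real.pi)) {x : ℕ → ℝ}
    (hx : ∀ β γ : ℕ → ℝ,
      Tendsto (fun n => avg (fun t => (x t : ℂ) * phase (β n) (γ n) t) n) atTop (𝓝 0))
    {θ : ℕ → Param} (hθ : ∀ n, 1 ≤ n →
      IsLSE M (fun t => signal (A₀, B₀, α₀, C₀, D₀, β₀) t + x t) n (θ n)) :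
    Tendsto θ atTop (𝓝 (A₀, B₀, α₀, C₀, D₀, β₀)) := by
  have hmem := interior_subset hint
  simp only [paramSpace, interior_prod_eq, interior_Icc, Set.mem_prod] at hint
  obtain ⟨-, -, hα₀, -, -, hβ₀'⟩ := hint
  -- Along an ultrafilter the estimates converge in the compact parameter space, without extracting
  -- subsequences; it remains to identify the limit.
  rw [tendsto_iff_ultrafilter]
  intro U hU
  have hev : ∀ᶠ n in U, 1 ≤ n := hU (eventually_ge_atTop 1)
  obtain ⟨⟨A', B', α', C', D', β'⟩, hθ', hlim⟩ :=
    (isCompact_paramSpace M).ultrafilter_le_nhds (U.map θ) (by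
      rw [le_principal_iff, Ultrafilter.coe_map, mem_map]
      filter_upwards [hev] with n hn using (hθ n hn).1)
  replace hlim : Tendsto θ U (𝓝 (A', B', α', C', D', β')) := hlim
  have h2 := (continuous_snd.tendsto _).comp hlim
  have h3 := (continuous_snd.tendsto _).comp h2
  have h4 := (continuous_snd.tendsto _).comp h3
  have h5 := (continuous_snd.tendsto _).comp h4
  have ha := tendsto_mk ((continuous_fst.tendsto _).comp hlim) ((continuous_fst.tendsto _).comp h2)
  have hα := (continuous_fst.tendsto _).comp h3
  have hc := tendsto_mk ((continuous_fst.tendsto _).comp h4) ((continuous_fst.tendsto _).comp h5)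
  have hβ := (continuous_snd.tendsto _).comp h5
  simp only [Function.comp_def] at ha hα hc hβ
  have hsig : ∀ n t, signal (θ n) t =
      ((⟨(θ n).1, -(θ n).2.1⟩ : ℂ) * phase 0 (θ n).2.2.1 t).re +
        ((⟨(θ n).2.2.2.1, -(θ n).2.2.2.2.1⟩ : ℂ) * phase (θ n).2.2.2.2.2 0 t).re :=
    fun n t => signal_eq_re _ _ _ _ _ _ t
  have hnoise : Tendsto (fun n => 2 * (avg (fun t => x t * signal (θ n) t) n -
      avg (fun t => x t * signal (A₀, B₀, α₀, C₀, D₀, β₀) t) n)) U (𝓝 0) := by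
    have hx' := fun β γ => (hx β γ).mono_left hU
    have n1 := (tendsto_avg_noise_mul_re ha (hx' (fun _ => 0) fun n => (θ n).2.2.1)).add
      (tendsto_avg_noise_mul_re hc (hx' (fun n => (θ n).2.2.2.2.2) fun _ => 0))
    have n2 := (tendsto_avg_noise_mul_re (tendsto_const_nhds (x := (⟨A₀, -B₀⟩ : ℂ)))
      (hx' (fun _ => 0) fun _ => α₀)).add
      (tendsto_avg_noise_mul_re (tendsto_const_nhds (x := (⟨C₀, -D₀⟩ : ℂ)))
      (hx' (fun _ => β₀) fun _ => 0))
    have n3 := (n1.sub n2).const_mul 2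
    simp only [add_zero, sub_zero, mul_zero] at n3
    refine n3.congr fun n => ?_
    simp only [hsig, signal_eq_re, mul_add, avg_add]
  have hsq := squeeze_zero' (f := fun n => avg (fun t =>
      (signal (θ n) t - signal (A₀, B₀, α₀, C₀, D₀, β₀) t) ^ 2) n)
    (Eventually.of_forall fun n => avg_nonneg fun t => sq_nonneg _) (by
      filter_upwards [hev] with n hn
      exact avg_sq_sub_le_of_errorSS_le ((hθ n hn).2 _ hmem)) hnoise
  have hfin := eq_of_tendsto_avg_sq hU ha hc (mk_ne_zero hAB) (mk_ne_zero hCD) hα hβ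
    hθ'.2.2.1 hθ'.2.2.2.2.2 hα₀ hβ₀' hβ₀ (hsq.congr fun n => avg_congr fun t => by
      rw [hsig, signal_eq_re]; ring)
  obtain ⟨e1, rfl, e2, rfl⟩ := hfin
  simp only [Complex.mk.injEq, neg_inj] at e1 e2
  obtain ⟨rfl, rfl⟩ := e1
  obtain ⟨rfl, rfl⟩ := e2
  exact hlim

end ChirpLike

theorem theorem1 {Ω : Type*} [MeasurableSpace Ω] (μ : Measure Ω) [IsProbabilityMeasure μ]
    (a : ℤ → ℝ) (σ : ℝ) (e X : ℤ → Ω → ℝ) (hX : ChirpLike.IsLinearProcess μ a σ e X)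
    (M : ℝ) (hM : 0 < M) (A₀ B₀ α₀ C₀ D₀ β₀ : ℝ)
    (hint : (A₀, B₀, α₀, C₀, D₀, β₀) ∈ interior (ChirpLike.paramSpace M))
    (hAB : 0 < A₀ ^ 2 + B₀ ^ 2) (hCD : 0 < C₀ ^ 2 + D₀ ^ 2)
    (hβ : Irrational (β₀ / Real.pi))
    (θhat : ℕ → Ω → ChirpLike.Param)
    (hθhat : ∀ᵐ ω ∂μ, ∀ n : ℕ, 1 ≤ n → ChirpLike.IsLSE M
      (fun t => ChirpLike.observation (A₀, B₀, α₀, C₀, D₀, β₀) X t ω) n (θhat n ω)) :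
    ∀ᵐ ω ∂μ, Tendsto (fun n => θhat n ω) atTop (𝓝 (A₀, B₀, α₀, C₀, D₀, β₀)) := by
  filter_upwards [hX.ae_tendsto_avg_mul_phase, hθhat] with ω h1 h2
  exact ChirpLike.tendsto_of_isLSE hint hAB hCD hβ h1 h2
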